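/- Let $a>b>c>0$. For $s_3\in[0,\pi)$, $s_3\neq 0,\tfrac{\pi}{2}$, let $\mathcal E(s_3)\subset\mathbb R^3$ be the ellipsoid $$\frac{b-c}{a-c}\,\frac{x^2}{\cos^2 s_3}+y^2+\frac{a-b}{a-c}\,\frac{z^2}{\sin^2 s_3}=1,$$ and let $\mathcal E(0)$ and $\mathcal E(\tfrac\pi2)$ be the flat elliptical discs $\{z=0,\ \frac{b-c}{a-c}x^2+y^2\le 1\}$ and $\{x=0,\ y^2+\frac{a-b}{a-c}z^2\le 1\}$. Put $$s_1^0=\arcsin\sqrt{\tfrac{a-b}{a-c}},\qquad s_2^0=\arccos\sqrt{\tfrac{a-b}{a-c}},\qquad R=[-s_1^0,s_1^0]\times[-s_2^0,s_2^0],$$ so that $s_1^0+s_2^0=\frac\pi2$, and define $\mathbf r_\pm(\cdot,\cdot,s_3)=(x,y,z):R\to\mathbb R^3$ by $$x=\frac{a-c}{\sqrt{(a-b)(b-c)}}\sin s_1\cos s_2\cos s_3,\qquad z=\frac{a-c}{\sqrt{(a-b)(b-c)}}\cos s_1\sin s_2\sin s_3,$$ $$y=\pm\sqrt{\frac{a-b}{b-c}}\,\sqrt{1-\frac{a-c}{a-b}\sin^2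 s_1}\,\sqrt{\frac{a-c}{a-b}\cos^2 s_2-1}.$$ 1. For each $s_3\in[0,\pi)$ the maps $\mathbf r_+$ and $\mathbf r_-$ are continuous with images $\mathcal E(s_3)\cap\{y\ge0\}$ and $\mathcal E(s_3)\cap\{y\le0\}$, respectively. If $s_3\ne0,\frac\pi2$, they are bijections from $R$ onto these halves, and on the interior of $R$ they are smooth immersions whose coordinate lines are orthogonal lines of curvature. If $s_3=0$ (respectively $s_3=\frac\pi2$), each half disc is covered twice: the restrictions to $R\cap\{s_2\ge0\}$ and to $R\cap\{s_2\le0\}$ (respectively $R\cap\{s_1\ge0\}$ and $R\cap\{s_1\le 0\}$) are bijections onto the half disc, and on the interior of $R$ without the line $s_2=0$ (respectively $s_1=0$) the maps are smooth immersions whose coordinate lines are orthogonal lines of curvature of the plane disc (in the sense $\partial_iN=-\kappa_i\partial_i\mathbf r$, with $N$ a smooth unit normal). 2. For $k\in[-\frac\pi2,\frac\pi2]$, a fixed choice of the sign in $s_1\pm s_2=k$, and $s_3\in[0,\pi)$, let $C(s_3)$ be the curve $s_1\pm s_2=k$, that is, the union of the images under $\mathbf r_+$ and $\mathbf r_-$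 of the set of all $(s_1,s_2)\in R$ with $s_1\pm s_2=k$. Then $C(s_3)$ is a circle in a plane, with a radius that does not depend on $s_3$ and is positive if and only if $|k|<\frac\pi2$ (for $|k|=\frac\pi2$ the circle is a single point). For $s_3\neq0,\frac\pi2$ it is the intersection of $\mathcal E(s_3)$ with that plane. For any two values $s_3,s_3'\in[0,\pi)$ the circles $C(s_3)$ and $C(s_3')$ are congruent; more precisely, there is an isometry of $\mathbb R^3$ that maps $C(s_3)$ onto $C(s_3')$ and $\mathbf r_\pm(s_1,s_2,s_3)$ to $\mathbf r_\pm(s_1,s_2,s_3')$ for all $(s_1,s_2)$ on the line and both signs of $y$. 3. For $s_3\in[0,\pi)$, $\mathcal E(s_3)$ lies in the plane $z=0$ if and only if $s_3=0$, and in the plane $x=0$ if and only if $s_3=\frac\pi2$; these two planar members are the limits of the ellipsoids $\mathcal E(t)$ in the Hausdorff distance as $t\to0$ and $t\to\frac\pi2$. For $s_3^\circ=\arctan\sqrt{\frac{a-b}{b-c}}\in(0,\frac\pi2)$, $\mathcal E(s_3^\circ)$ is the unit sphere $x^2+y^2+z^2=1$. -/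

import Mathlib

open Set Filter Topology
open scoped ContDiff

noncomputable section

/-- Euclidean three-space, with coordinates `p 0 = x`, `p 1 = y`, `p 2 = z`. -/
abbrev E3 : Type := EuclideanSpace ℝ (Fin 3)

/-- The ellipsoid `(b-c)/(a-c) x²/cos² s₃ + y² + (a-b)/(a-c) z²/sin² s₃ = 1`
(meaningful when `cos s₃ ≠ 0` and `sin s₃ ≠ 0`). -/
def ellipsoid (a b c s₃ : ℝ) : Set E3 :=
  {p | (b - c) / (a - c) * ((p 0) ^ 2 / Real.cos s₃ ^ 2) + (p 1) ^ 2
      + (a - b) / (a - c) * ((p 2) ^ 2 / Real.sin s₃ ^ 2) = 1}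

/-- The flat elliptical disc in the plane `z = 0` to which the ellipsoids collapse
as `sin s₃ → 0`. -/
def flatDiscXY (a b c : ℝ) : Set E3 :=
  {p | p 2 = 0 ∧ (b - c) / (a - c) * (p 0) ^ 2 + (p 1) ^ 2 ≤ 1}

/-- The flat elliptical disc in the plane `x = 0` to which the ellipsoids collapse
as `cos s₃ → 0`. -/
def flatDiscYZ (a b c : ℝ) : Set E3 :=
  {p | p 0 = 0 ∧ (p 1) ^ 2 + (a - b) / (a - c) * (p 2) ^ 2 ≤ 1}

/-- The family of (possibly degenerate) ellipsoids: the quadric given by the equation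
when its denominators do not vanish, and the flat discs otherwise. -/
def ellipsoidFamily (a b c s₃ : ℝ) : Set E3 :=
  {p | (Real.sin s₃ ≠ 0 ∧ Real.cos s₃ ≠ 0 ∧ p ∈ ellipsoid a b c s₃)
      ∨ (Real.sin s₃ = 0 ∧ p ∈ flatDiscXY a b c)
      ∨ (Real.cos s₃ = 0 ∧ p ∈ flatDiscYZ a b c)}

/-- The closed half-space `y ≥ 0` for `ε = 1` and `y ≤ 0` for `ε = -1`. -/
def halfSpace (ε : ℝ) : Set E3 := {p | 0 ≤ ε * p 1}

def s₁Max (a b c : ℝ) : ℝ := Real.arcsin √((a - b) / (a - c))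

def s₂Max (a b c : ℝ) : ℝ := Real.arccos √((a - b) / (a - c))

/-- The parameter rectangle `[-s₁⁰, s₁⁰] × [-s₂⁰, s₂⁰]`. -/
def rect (a b c : ℝ) : Set (ℝ × ℝ) :=
  Icc (-s₁Max a b c) (s₁Max a b c) ×ˢ Icc (-s₂Max a b c) (s₂Max a b c)

/-- The open parameter rectangle. -/
def openRect (a b c : ℝ) : Set (ℝ × ℝ) :=
  Ioo (-s₁Max a b c) (s₁Max a b c) ×ˢ Ioo (-s₂Max a b c) (s₂Max a b c)

/-- The two explicit parametrizations; `ε = 1` and `ε = -1` select the sign of `y`. -/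
def param (a b c ε s₃ : ℝ) (s : ℝ × ℝ) : E3 :=
  !₂[(a - c) / √((a - b) * (b - c)) * Real.sin s.1 * Real.cos s.2 * Real.cos s₃,
     ε * √((a - b) / (b - c)) * √(1 - (a - c) / (a - b) * Real.sin s.1 ^ 2)
        * √((a - c) / (a - b) * Real.cos s.2 ^ 2 - 1),
     (a - c) / √((a - b) * (b - c)) * Real.cos s.1 * Real.sin s.2 * Real.sin s₃]

/-- `r` is a regular smooth parametrization on the open set `U` both of whose families of
coordinate lines are lines of curvature: with `N` a smooth unit normal field,
the coordinate directions are orthogonal and are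
principal directions, `∂ᵢ N = -κᵢ ∂ᵢ r`. -/
def IsCurvatureLineParametrizationOn (r : ℝ × ℝ → E3) (U : Set (ℝ × ℝ)) : Prop :=
  IsOpen U ∧ ContDiffOn ℝ ∞ r U ∧ (∀ p ∈ U, Function.Injective (fderiv ℝ r p)) ∧
  ∃ N : ℝ × ℝ → E3, ContDiffOn ℝ ∞ N U ∧ ∀ p ∈ U,
    ‖N p‖ = 1 ∧ (∀ v : ℝ × ℝ, inner ℝ (N p) (fderiv ℝ r p v) = 0) ∧
    inner ℝ (fderiv ℝ r p (1, 0)) (fderiv ℝ r p (0, 1)) = 0 ∧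
    (∃ κ₁ : ℝ, fderiv ℝ N p (1, 0) = -κ₁ • fderiv ℝ r p (1, 0)) ∧
    (∃ κ₂ : ℝ, fderiv ℝ N p (0, 1) = -κ₂ • fderiv ℝ r p (0, 1))

/-- The part of the line `s₁ + δ s₂ = k` (`δ = ±1`) that lies in the parameter rectangle. -/
def diagLine (a b c δ k : ℝ) : Set (ℝ × ℝ) :=
  {s | s ∈ rect a b c ∧ s.1 + δ * s.2 = k}

/-- The curve `s₁ + δ s₂ = k` on the (possibly degenerate) ellipsoid with parameter `s₃`,
consisting of its two arcs, one on each half. -/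
def diagCurve (a b c δ k s₃ : ℝ) : Set E3 :=
  param a b c 1 s₃ '' diagLine a b c δ k ∪ param a b c (-1) s₃ '' diagLine a b c δ k

/-- `P` is a plane, and `C` is the circle of radius `ρ` about some point of `P` in `P`. -/
def IsCircleInPlane (P : AffineSubspace ℝ E3) (ρ : ℝ) (C : Set E3) : Prop :=
  Module.finrank ℝ P.direction = 2 ∧ ∃ m ∈ P, C = (P : Set E3) ∩ Metric.sphere m ρ

end

noncomputable section

/-! Put `α = s₁⁰`, so that `sin² α = (a-b)/(a-c)` and `cos² α = (b-c)/(a-c)`. Every member of the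
family, flat ones included, is the image of one ellipsoid `cos² α X² + Y² + sin² α Z² = 1` under the
linear map `(X, Y, Z) ↦ (X cos s₃, Y, Z sin s₃)` (`mem_ellipsoidFamily_iff`), and `s₃` enters the
parametrization only through this map.

On the fixed ellipsoid, the addition formula gives `X ± Z = sin (s₁ ± s₂) / (sin α cos α)`
(`stdX_add_stdZ`). Since `s₁ ± s₂` stays in `[-π/2, π/2]`, where sine is injective, `X` and `Z`
determine the parameters; `exists_of_onStd` inverts the formula with arcsines. In the flat cases `X`
or `Z` is lost, but the equation of the ellipsoid recovers its square, hence the two sheets.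

By the same formula the line `s₁ + δ s₂ = k` is the section by the plane `X + δ Z = κ`. The linear
map is isometric on this plane: it sends the direction `(1, 0, -δ)` to the unit vector `(cos s₃, 0,
-δ sin s₃)` and fixes the `Y` direction. Substituting `δ Z = κ - X` turns the ellipsoid equation
into `(X - κ sin² α)² + Y² = cos² k`, a circle in the coordinates `X, Y`, whatever `s₃` is.

For the curvature lines, the gradient, multiplied by `cos s₃ sin s₃` to remain finite on the discs,
has a length that factors into a function of `s₁` times a function of `s₂`. Each component of the
unit normal is therefore a product of one-variable functions, and differentiating one factor gives a
multiple of the same derivative of the parametrization. -/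

/-! ### The standard ellipsoid and its angle parameters. -/

/-- The parameter rectangle in terms of the angle `α = s₁⁰`. -/
def stdRect (α : ℝ) : Set (ℝ × ℝ) :=
  Icc (-α) α ×ˢ Icc (-(Real.pi / 2 - α)) (Real.pi / 2 - α)

/-- The first coordinate of the parametrization, divided by `cos s₃`. -/
def stdX (α : ℝ) (s : ℝ × ℝ) : ℝ := Real.sin s.1 * Real.cos s.2 / (Real.sin α * Real.cos α)

/-- The absolute value of the second coordinate of the parametrization. -/
def stdY (α : ℝ) (s : ℝ × ℝ) : ℝ :=
  √(Real.sin α ^ 2 - Real.sin s.1 ^ 2) * √(Real.cos α ^ 2 - Real.sin s.2 ^ 2)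
    / (Real.sin α * Real.cos α)

/-- The third coordinate of the parametrization, divided by `sin s₃`. -/
def stdZ (α : ℝ) (s : ℝ × ℝ) : ℝ := Real.cos s.1 * Real.sin s.2 / (Real.sin α * Real.cos α)

/-- The parametrization in terms of the angle `α = s₁⁰`. -/
def stdParam (α ε θ : ℝ) (s : ℝ × ℝ) : E3 :=
  !₂[stdX α s * Real.cos θ, ε * stdY α s, stdZ α s * Real.sin θ]

/-- The ellipsoid `cos² α X² + Y² + sin² α Z² = 1`, of which all members of the family are
linear images. -/
def OnStd (α X Y Z : ℝ) : Prop :=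
  Real.cos α ^ 2 * X ^ 2 + Y ^ 2 + Real.sin α ^ 2 * Z ^ 2 = 1

lemma sin_pos_of_mem {α : ℝ} (hα : α ∈ Ioo 0 (Real.pi / 2)) : 0 < Real.sin α :=
  Real.sin_pos_of_pos_of_lt_pi hα.1 (by linarith [hα.2, Real.pi_pos])

lemma cos_pos_of_mem {α : ℝ} (hα : α ∈ Ioo 0 (Real.pi / 2)) : 0 < Real.cos α :=
  Real.cos_pos_of_mem_Ioo ⟨by linarith [hα.1, Real.pi_pos], hα.2⟩

lemma sin_sq_le_sin_sq {x α : ℝ} (hx : x ∈ Icc (-α) α) (h2 : α ≤ Real.pi / 2) :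
    Real.sin x ^ 2 ≤ Real.sin α ^ 2 := by
  have hpi := Real.pi_pos
  apply sq_le_sq'
  · rw [← Real.sin_neg]
    exact Real.sin_le_sin_of_le_of_le_pi_div_two (by linarith) (by linarith [hx.1, hx.2]) hx.1
  · exact Real.sin_le_sin_of_le_of_le_pi_div_two (by linarith [hx.1]) h2 hx.2

lemma sin_sq_lt_sin_sq {x α : ℝ} (hx : x ∈ Ioo (-α) α) (h2 : α ≤ Real.pi / 2) :
    Real.sin x ^ 2 < Real.sin α ^ 2 := by
  have hpi := Real.pi_pos
  apply sq_lt_sq'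
  · rw [← Real.sin_neg]
    exact Real.sin_lt_sin_of_lt_of_le_pi_div_two (by linarith) (by linarith [hx.1, hx.2]) hx.1
  · exact Real.sin_lt_sin_of_lt_of_le_pi_div_two (by linarith [hx.1]) h2 hx.2

lemma stdY_sq {α : ℝ} (hα : α ∈ Ioo 0 (Real.pi / 2)) {s : ℝ × ℝ} (hs : s ∈ stdRect α) :
    stdY α s ^ 2 = (Real.sin α ^ 2 - Real.sin s.1 ^ 2) * (Real.cos α ^ 2 - Real.sin s.2 ^ 2)
      / (Real.sin α * Real.cos α) ^ 2 := by
  have h1 := sin_sq_le_sin_sq hs.1 hα.2.le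
  have h2 := sin_sq_le_sin_sq hs.2 (by linarith [hα.1])
  rw [Real.sin_pi_div_two_sub] at h2
  rw [stdY, div_pow, mul_pow, Real.sq_sqrt (by linarith), Real.sq_sqrt (by linarith)]

lemma stdY_nonneg {α : ℝ} (hα : α ∈ Ioo 0 (Real.pi / 2)) (s : ℝ × ℝ) : 0 ≤ stdY α s := by
  have hS := sin_pos_of_mem hα
  have hC := cos_pos_of_mem hα
  unfold stdY
  positivity

lemma onStd_of_mem_stdRect {α : ℝ} (hα : α ∈ Ioo 0 (Real.pi / 2)) {s : ℝ × ℝ}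
    (hs : s ∈ stdRect α) : OnStd α (stdX α s) (stdY α s) (stdZ α s) := by
  have hS := sin_pos_of_mem hα
  have hC := cos_pos_of_mem hα
  rw [OnStd, stdY_sq hα hs, stdX, stdZ]
  have h1 := Real.cos_sq' s.1
  have h2 := Real.cos_sq' s.2
  have h3 := Real.sin_sq_add_cos_sq α
  field_simp
  rw [h1, h2]
  linear_combination (-Real.sin s.1 ^ 2 * Real.sin s.2 ^ 2) * h3

lemma stdX_add_stdZ (α δ : ℝ) (hδ : δ = 1 ∨ δ = -1) (s : ℝ × ℝ) :
    stdX α s + δ * stdZ α s = Real.sin (s.1 + δ * s.2) / (Real.sin α * Real.cos α) := by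
  rw [stdX, stdZ]
  rcases hδ with rfl | rfl
  · rw [one_mul, one_mul, Real.sin_add]; ring
  · rw [neg_one_mul, neg_one_mul, ← sub_eq_add_neg s.1, Real.sin_sub]; ring

lemma add_mem_Icc_of_mem_stdRect {α : ℝ} {s : ℝ × ℝ} (hs : s ∈ stdRect α) {δ : ℝ}
    (hδ : δ = 1 ∨ δ = -1) : s.1 + δ * s.2 ∈ Icc (-(Real.pi / 2)) (Real.pi / 2) := by
  obtain ⟨⟨h1, h2⟩, h3, h4⟩ := hs
  rcases hδ with rfl | rfl <;> constructor <;> linarith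

lemma stdX_stdZ_injOn {α : ℝ} (hα : α ∈ Ioo 0 (Real.pi / 2)) {s t : ℝ × ℝ}
    (hs : s ∈ stdRect α) (ht : t ∈ stdRect α) (hX : stdX α s = stdX α t)
    (hZ : stdZ α s = stdZ α t) : s = t := by
  have hS := sin_pos_of_mem hα
  have hC := cos_pos_of_mem hα
  have key : ∀ δ : ℝ, δ = 1 ∨ δ = -1 → s.1 + δ * s.2 = t.1 + δ * t.2 := by
    intro δ hδ
    apply Real.injOn_sin (add_mem_Icc_of_mem_stdRect hs hδ) (add_mem_Icc_of_mem_stdRect ht hδ)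
    have h1 := stdX_add_stdZ α δ hδ s
    rw [hX, hZ, stdX_add_stdZ α δ hδ t] at h1
    exact ((div_left_inj' (mul_pos hS hC).ne').1 h1).symm
  have h1 := key 1 (Or.inl rfl)
  have h2 := key (-1) (Or.inr rfl)
  ext <;> linarith

/-- The values of `sin (s₁ ± s₂)` are prescribed by `X ± Z`, so arcsines give `s`. What remains is
that `s` lies in the rectangle, which comes from a sign argument. -/
lemma exists_of_onStd {α : ℝ} (hα : α ∈ Ioo 0 (Real.pi / 2)) {X Y Z : ℝ}
    (h : OnStd α X Y Z) : ∃ s ∈ stdRect α, stdX α s = X ∧ stdY α s = |Y| ∧ stdZ α s = Z := by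
  have hpi := Real.pi_pos
  have hS := sin_pos_of_mem hα
  have hC := cos_pos_of_mem hα
  have hSC := Real.sin_sq_add_cos_sq α
  unfold OnStd at h
  set S := Real.sin α with hSdef
  set C := Real.cos α with hCdef
  have bound : ∀ δ : ℝ, δ = 1 ∨ δ = -1 → |S * C * (X + δ * Z)| ≤ 1 := by
    intro δ hδ
    have hδ2 : δ ^ 2 = 1 := by rcases hδ with rfl | rfl <;> norm_num
    apply abs_le_one_iff_mul_self_le_one.2
    -- Lagrange's identity, the explicit form of Cauchy–Schwarz for `(S, δ C)` and `(C X, S Z)`.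
    have : S * C * (X + δ * Z) * (S * C * (X + δ * Z))
        = (S ^ 2 + C ^ 2) * (C ^ 2 * X ^ 2 + S ^ 2 * Z ^ 2)
          - (C ^ 2 * X - δ * S ^ 2 * Z) ^ 2 := by
      linear_combination (S ^ 2 * C ^ 2 * Z ^ 2 + S ^ 4 * Z ^ 2) * hδ2
    rw [this, hSC]
    nlinarith [sq_nonneg Y, sq_nonneg (C ^ 2 * X - δ * S ^ 2 * Z)]
  have b1 := abs_le.1 (bound 1 (Or.inl rfl))
  have b2 := abs_le.1 (bound (-1) (Or.inr rfl))
  set A := Real.arcsin (S * C * (X + 1 * Z)) with hA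
  set B := Real.arcsin (S * C * (X + -1 * Z)) with hB
  have hsA : Real.sin A = S * C * (X + 1 * Z) := Real.sin_arcsin b1.1 b1.2
  have hsB : Real.sin B = S * C * (X + -1 * Z) := Real.sin_arcsin b2.1 b2.2
  have hA1 := Real.neg_pi_div_two_le_arcsin (S * C * (X + 1 * Z))
  have hA2 := Real.arcsin_le_pi_div_two (S * C * (X + 1 * Z))
  have hB1 := Real.neg_pi_div_two_le_arcsin (S * C * (X + -1 * Z))
  have hB2 := Real.arcsin_le_pi_div_two (S * C * (X + -1 * Z))
  rw [← hA] at hA1 hA2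
  rw [← hB] at hB1 hB2
  set s : ℝ × ℝ := ((A + B) / 2, (A - B) / 2) with hsdef
  have e1 : Real.sin s.1 * Real.cos s.2 + Real.cos s.1 * Real.sin s.2 = S * C * (X + 1 * Z) := by
    rw [← hsA, ← Real.sin_add]; congr 1; simp only [hsdef]; ring
  have e2 : Real.sin s.1 * Real.cos s.2 - Real.cos s.1 * Real.sin s.2 = S * C * (X + -1 * Z) := by
    rw [← hsB, ← Real.sin_sub]; congr 1; simp only [hsdef]; ring
  have eX : Real.sin s.1 * Real.cos s.2 = S * C * X := by linarith
  have eZ : Real.cos s.1 * Real.sin s.2 = S * C * Z := by linarith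
  -- This yields the value of `stdY`; its nonnegativity also forces the two factors not to have
  -- opposite signs.
  have prod : (S ^ 2 - Real.sin s.1 ^ 2) * (C ^ 2 - Real.sin s.2 ^ 2) = (S * C * Y) ^ 2 := by
    have h1 := Real.cos_sq' s.1
    have h2 := Real.cos_sq' s.2
    have eX2 : Real.sin s.1 ^ 2 * (1 - Real.sin s.2 ^ 2) = (S * C * X) ^ 2 := by
      rw [← h2, ← mul_pow, eX]
    have eZ2 : (1 - Real.sin s.1 ^ 2) * Real.sin s.2 ^ 2 = (S * C * Z) ^ 2 := by
      rw [← h1, ← mul_pow, eZ]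
    linear_combination (-C ^ 2) * eX2 - S ^ 2 * eZ2 - (S ^ 2 * C ^ 2) * h
      - (Real.sin s.1 ^ 2 * Real.sin s.2 ^ 2) * hSC
  have l1 : |s.1| + |s.2| ≤ Real.pi / 2 := by
    simp only [hsdef]
    rcases abs_cases ((A + B) / 2) with h1 | h1 <;> rcases abs_cases ((A - B) / 2) with h2 | h2 <;>
      linarith
  have hs : s ∈ stdRect α := by
    suffices |s.1| ≤ α ∧ |s.2| ≤ Real.pi / 2 - α from ⟨abs_le.1 this.1, abs_le.1 this.2⟩
    have n1 := abs_nonneg s.1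
    have n2 := abs_nonneg s.2
    have q1 : 0 ≤ (S ^ 2 - Real.sin |s.1| ^ 2) * (C ^ 2 - Real.sin |s.2| ^ 2) := by
      have e : ∀ x : ℝ, Real.sin |x| ^ 2 = Real.sin x ^ 2 := fun x => by
        rcases abs_choice x with h | h <;> simp [h]
      rw [e, e, prod]
      positivity
    -- Because `|s₁| + |s₂| ≤ π/2`, if one parameter leaves its interval the other lies strictly
    -- inside its own, and the product would be negative.
    by_contra hcon
    rw [not_and_or, not_le, not_le] at hcon
    rcases hcon with h1 | h1
    · have i1 := sin_sq_lt_sin_sq (x := α) (α := |s.1|) ⟨by linarith [hα.1], h1⟩ (by linarith)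
      have i2 := sin_sq_lt_sin_sq (x := |s.2|) (α := Real.pi / 2 - α)
        ⟨by linarith, by linarith⟩ (by linarith [hα.1])
      rw [Real.sin_pi_div_two_sub] at i2
      nlinarith
    · have i1 := sin_sq_lt_sin_sq (x := Real.pi / 2 - α) (α := |s.2|)
        ⟨by linarith [hα.2], h1⟩ (by linarith)
      have i2 := sin_sq_lt_sin_sq (x := |s.1|) (α := α)
        ⟨by linarith, by linarith⟩ (by linarith [hα.2])
      rw [Real.sin_pi_div_two_sub] at i1
      nlinarith
  refine ⟨s, hs, ?_, ?_, ?_⟩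
  · rw [stdX, ← hSdef, ← hCdef, eX]; field_simp
  · rw [← abs_of_nonneg (stdY_nonneg hα s), ← sq_eq_sq_iff_abs_eq_abs, stdY_sq hα hs,
      ← hSdef, ← hCdef, prod]
    field_simp
  · rw [stdZ, ← hSdef, ← hCdef, eZ]; field_simp

/-! ### Translation from `a, b, c` to the angle `α`. -/

lemma s₁Max_mem {a b c : ℝ} (hab : b < a) (hbc : c < b) :
    s₁Max a b c ∈ Ioo 0 (Real.pi / 2) := by
  have h1 : 0 < (a - b) / (a - c) := div_pos (by linarith) (by linarith)
  refine ⟨Real.arcsin_pos.2 (Real.sqrt_pos.2 h1), Real.arcsin_lt_pi_div_two.2 ?_⟩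
  rw [Real.sqrt_lt' one_pos, one_pow, div_lt_one (by linarith)]
  linarith

lemma sin_s₁Max_sq {a b c : ℝ} (hab : b < a) (hbc : c < b) :
    Real.sin (s₁Max a b c) ^ 2 = (a - b) / (a - c) := by
  have h1 : 0 < (a - b) / (a - c) := div_pos (by linarith) (by linarith)
  rw [s₁Max, Real.sin_arcsin (by linarith [Real.sqrt_nonneg ((a - b) / (a - c))]),
    Real.sq_sqrt h1.le]
  rw [Real.sqrt_le_one, div_le_one (by linarith)]
  linarith

lemma cos_s₁Max_sq {a b c : ℝ} (hab : b < a) (hbc : c < b) :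
    Real.cos (s₁Max a b c) ^ 2 = (b - c) / (a - c) := by
  have : a - c ≠ 0 := by linarith
  rw [Real.cos_sq', sin_s₁Max_sq hab hbc]
  field_simp
  ring

lemma rect_eq (a b c : ℝ) : rect a b c = stdRect (s₁Max a b c) := rfl

lemma sub_div_sqrt_eq {a b c : ℝ} (hab : b < a) (hbc : c < b) :
    (a - c) / √((a - b) * (b - c))
      = 1 / (Real.sin (s₁Max a b c) * Real.cos (s₁Max a b c)) := by
  have h : a - c ≠ 0 := by linarith
  have hα := s₁Max_mem hab hbc
  have hS := sin_pos_of_mem hα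
  have hC := cos_pos_of_mem hα
  have hac : 0 < a - c := by linarith
  have : √((a - b) * (b - c))
      = (a - c) * (Real.sin (s₁Max a b c) * Real.cos (s₁Max a b c)) := by
    rw [Real.sqrt_eq_iff_eq_sq (mul_nonneg (by linarith) (by linarith)) (by positivity),
      mul_pow, mul_pow, sin_s₁Max_sq hab hbc, cos_s₁Max_sq hab hbc]
    field_simp
  rw [this]
  field_simp

lemma param_eq_stdParam {a b c : ℝ} (hab : b < a) (hbc : c < b) (ε θ : ℝ) :
    param a b c ε θ = stdParam (s₁Max a b c) ε θ := by
  have h : a - c ≠ 0 := by linarith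
  have h1 : a - b ≠ 0 := by linarith
  have h2 : b - c ≠ 0 := by linarith
  have hα := s₁Max_mem hab hbc
  have hS := sin_pos_of_mem hα
  have hC := cos_pos_of_mem hα
  have hS2 := sin_s₁Max_sq hab hbc
  have hC2 := cos_s₁Max_sq hab hbc
  have hSC := Real.sin_sq_add_cos_sq (s₁Max a b c)
  funext s
  rw [param, stdParam, stdX, stdY, stdZ, sub_div_sqrt_eq hab hbc]
  have e1 : (a - b) / (b - c) = Real.sin (s₁Max a b c) ^ 2 / Real.cos (s₁Max a b c) ^ 2 := by
    rw [hS2, hC2]; field_simp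
  have e2 : (a - c) / (a - b) = 1 / Real.sin (s₁Max a b c) ^ 2 := by
    rw [hS2]; field_simp
  have e3 : 1 - (a - c) / (a - b) * Real.sin s.1 ^ 2
      = (Real.sin (s₁Max a b c) ^ 2 - Real.sin s.1 ^ 2) / Real.sin (s₁Max a b c) ^ 2 := by
    rw [e2]; field_simp
  have e4 : (a - c) / (a - b) * Real.cos s.2 ^ 2 - 1
      = (Real.cos (s₁Max a b c) ^ 2 - Real.sin s.2 ^ 2) / Real.sin (s₁Max a b c) ^ 2 := by
    rw [e2, Real.cos_sq' s.2]; field_simp; linear_combination -hSC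
  rw [e1, e3, e4, Real.sqrt_div' _ (sq_nonneg _), Real.sqrt_div' _ (sq_nonneg _),
    Real.sqrt_div' _ (sq_nonneg _), Real.sqrt_sq hS.le, Real.sqrt_sq hC.le]
  congr 1
  ext i
  fin_cases i <;> simp <;> field_simp <;> simp

/-- All members of the family are images of one ellipsoid. -/
lemma mem_ellipsoidFamily_iff {a b c : ℝ} (hab : b < a) (hbc : c < b) (θ : ℝ) (p : E3) :
    p ∈ ellipsoidFamily a b c θ ↔ ∃ X Z, OnStd (s₁Max a b c) X (p 1) Z ∧
      p 0 = X * Real.cos θ ∧ p 2 = Z * Real.sin θ := by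
  have hα := s₁Max_mem hab hbc
  have hS := sin_pos_of_mem hα
  have hC := cos_pos_of_mem hα
  have hθ := Real.sin_sq_add_cos_sq θ
  simp only [ellipsoidFamily, ellipsoid, flatDiscXY, flatDiscYZ, mem_ofPred_eq, OnStd,
    ← sin_s₁Max_sq hab hbc, ← cos_s₁Max_sq hab hbc]
  set S := Real.sin (s₁Max a b c)
  set C := Real.cos (s₁Max a b c)
  constructor
  · rintro (⟨h1, h2, h⟩ | ⟨h1, h2, h⟩ | ⟨h1, h2, h⟩)
    · refine ⟨p 0 / Real.cos θ, p 2 / Real.sin θ, ?_, ?_, ?_⟩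
      · rw [div_pow, div_pow]; exact h
      · field_simp
      · field_simp
    · have hc2 : Real.cos θ ^ 2 = 1 := by rw [h1] at hθ; linarith
      have hc : Real.cos θ ≠ 0 := fun h => by simp [h] at hc2
      -- The disc is the projection of the standard ellipsoid: the disc inequality makes the
      -- radicand nonnegative, and `Z` is the height above the point.
      refine ⟨p 0 / Real.cos θ, √(1 - C ^ 2 * p 0 ^ 2 - p 1 ^ 2) / S, ?_, ?_, ?_⟩
      · rw [div_pow, div_pow, hc2, Real.sq_sqrt (by linarith)]; field_simp; ring
      · field_simp
      · rw [h1, h2, mul_zero]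
    · have hc2 : Real.sin θ ^ 2 = 1 := by rw [h1] at hθ; linarith
      have hc : Real.sin θ ≠ 0 := fun h => by simp [h] at hc2
      refine ⟨√(1 - S ^ 2 * p 2 ^ 2 - p 1 ^ 2) / C, p 2 / Real.sin θ, ?_, ?_, ?_⟩
      · rw [div_pow, div_pow, hc2, Real.sq_sqrt (by linarith)]; field_simp; ring
      · rw [h1, h2, mul_zero]
      · field_simp
  · rintro ⟨X, Z, h, h0, h2⟩
    rw [h0, h2]
    by_cases h3 : Real.sin θ = 0
    · have hc2 : Real.cos θ ^ 2 = 1 := by rw [h3] at hθ; linarith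
      refine Or.inr (Or.inl ⟨h3, by rw [h3, mul_zero], ?_⟩)
      rw [mul_pow, hc2]
      nlinarith [sq_nonneg (S * Z)]
    by_cases h4 : Real.cos θ = 0
    · have hc2 : Real.sin θ ^ 2 = 1 := by rw [h4] at hθ; linarith
      refine Or.inr (Or.inr ⟨h4, by rw [h4, mul_zero], ?_⟩)
      rw [mul_pow, hc2]
      nlinarith [sq_nonneg (C * X)]
    · refine Or.inl ⟨h3, h4, ?_⟩
      rw [← h]
      field_simp

lemma ellipsoidFamily_eq_ellipsoid {a b c θ : ℝ} (h1 : Real.sin θ ≠ 0) (h2 : Real.cos θ ≠ 0) :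
    ellipsoidFamily a b c θ = ellipsoid a b c θ := by
  ext p
  simp [ellipsoidFamily, h1, h2]

/-! ### Images, injectivity and the double cover of the discs. -/

lemma stdParam_apply (α ε θ : ℝ) (s : ℝ × ℝ) :
    stdParam α ε θ s 0 = stdX α s * Real.cos θ ∧ stdParam α ε θ s 1 = ε * stdY α s ∧
      stdParam α ε θ s 2 = stdZ α s * Real.sin θ := by
  simp [stdParam]

lemma continuous_stdParam (α ε θ : ℝ) : Continuous (stdParam α ε θ) := by
  unfold stdParam stdX stdY stdZ
  fun_prop

lemma E3.ext_iff {p q : E3} : p = q ↔ p 0 = q 0 ∧ p 1 = q 1 ∧ p 2 = q 2 := by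
  constructor
  · rintro rfl; simp
  · rintro ⟨h0, h1, h2⟩
    ext i
    fin_cases i
    exacts [h0, h1, h2]

lemma onStd_mul_sign {α ε X Y Z : ℝ} (hε : ε = 1 ∨ ε = -1) :
    OnStd α X (ε * Y) Z ↔ OnStd α X Y Z := by
  rcases hε with rfl | rfl <;> simp [OnStd]

lemma stdParam_mapsTo {a b c : ℝ} (hab : b < a) (hbc : c < b) (θ : ℝ) {ε : ℝ}
    (hε : ε = 1 ∨ ε = -1) : MapsTo (stdParam (s₁Max a b c) ε θ) (stdRect (s₁Max a b c))
      (ellipsoidFamily a b c θ ∩ halfSpace ε) := by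
  intro s hs
  have hα := s₁Max_mem hab hbc
  obtain ⟨h0, h1, h2⟩ := stdParam_apply (s₁Max a b c) ε θ s
  refine ⟨(mem_ellipsoidFamily_iff hab hbc θ _).2 ⟨_, _, ?_, h0, h2⟩, ?_⟩
  · rw [h1, onStd_mul_sign hε]; exact onStd_of_mem_stdRect hα hs
  · have := stdY_nonneg hα s
    rw [halfSpace, mem_ofPred_eq, h1]
    rcases hε with rfl | rfl <;> linarith

/-- `X` and `Z` are kept as data because in the flat cases `p` does not determine both; prescribing
them selects a sheet, or a line `s₁ + δ s₂ = k`. -/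
lemma exists_stdParam_eq {α ε θ X Z : ℝ} {p : E3} (hα : α ∈ Ioo 0 (Real.pi / 2))
    (hε : ε = 1 ∨ ε = -1) (h : OnStd α X (p 1) Z) (h0 : p 0 = X * Real.cos θ)
    (h2 : p 2 = Z * Real.sin θ) (hp : p ∈ halfSpace ε) :
    ∃ s ∈ stdRect α, stdX α s = X ∧ stdZ α s = Z ∧ stdParam α ε θ s = p := by
  obtain ⟨s, hs, hX, hY, hZ⟩ := exists_of_onStd hα h
  refine ⟨s, hs, hX, hZ, ?_⟩
  obtain ⟨g0, g1, g2⟩ := stdParam_apply α ε θ s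
  rw [E3.ext_iff, g0, g1, g2, hX, hY, hZ]
  refine ⟨h0.symm, ?_, h2.symm⟩
  have hp' : 0 ≤ ε * p 1 := hp
  rcases hε with rfl | rfl
  · rw [abs_of_nonneg (by linarith)]; ring
  · rw [abs_of_nonpos (by linarith)]; ring

lemma stdParam_image {a b c : ℝ} (hab : b < a) (hbc : c < b) (θ : ℝ) {ε : ℝ}
    (hε : ε = 1 ∨ ε = -1) : stdParam (s₁Max a b c) ε θ '' stdRect (s₁Max a b c)
      = ellipsoidFamily a b c θ ∩ halfSpace ε := by
  refine (stdParam_mapsTo hab hbc θ hε).image_subset.antisymm ?_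
  rintro p ⟨hp, hp'⟩
  obtain ⟨X, Z, h, h0, h2⟩ := (mem_ellipsoidFamily_iff hab hbc θ p).1 hp
  obtain ⟨s, hs, -, -, h⟩ := exists_stdParam_eq (s₁Max_mem hab hbc) hε h h0 h2 hp'
  exact ⟨s, hs, h⟩

lemma stdParam_injOn {α : ℝ} (hα : α ∈ Ioo 0 (Real.pi / 2)) (ε : ℝ) {θ : ℝ}
    (h1 : Real.sin θ ≠ 0) (h2 : Real.cos θ ≠ 0) : InjOn (stdParam α ε θ) (stdRect α) := by
  intro s hs t ht h
  rw [E3.ext_iff] at h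
  simp only [(stdParam_apply α ε θ _).1, (stdParam_apply α ε θ _).2.2] at h
  exact stdX_stdZ_injOn hα hs ht (mul_right_cancel₀ h2 h.1) (mul_right_cancel₀ h1 h.2.2)

lemma sin_nonneg_iff_of_mem_Icc {x : ℝ} (hx : x ∈ Icc (-(Real.pi / 2)) (Real.pi / 2)) :
    0 ≤ Real.sin x ↔ 0 ≤ x := by
  have h0 : (0 : ℝ) ∈ Icc (-(Real.pi / 2)) (Real.pi / 2) := by
    constructor <;> linarith [Real.pi_pos]
  simpa using Real.strictMonoOn_sin.le_iff_le h0 hx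

/-- On the rectangle `cos s₁ > 0`, so `Z` has the sign of `sin s₂`, hence of `s₂`. The sign `η`
names the sheet. -/
lemma sign_stdZ {α : ℝ} (hα : α ∈ Ioo 0 (Real.pi / 2)) {s : ℝ × ℝ} (hs : s ∈ stdRect α)
    {η : ℝ} (hη : η = 1 ∨ η = -1) : 0 ≤ η * stdZ α s ↔ 0 ≤ η * s.2 := by
  have hS := sin_pos_of_mem hα
  have hC := cos_pos_of_mem hα
  obtain ⟨⟨h1, h2⟩, h3, h4⟩ := hs
  have hc : 0 < Real.cos s.1 := Real.cos_pos_of_mem_Ioo ⟨by linarith [hα.2], by linarith [hα.2]⟩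
  have hkey : 0 ≤ Real.sin (η * s.2) ↔ 0 ≤ η * s.2 := by
    apply sin_nonneg_iff_of_mem_Icc
    rcases hη with rfl | rfl <;> constructor <;> linarith [hα.1]
  have e : η * stdZ α s = Real.cos s.1 / (Real.sin α * Real.cos α) * Real.sin (η * s.2) := by
    rcases hη with rfl | rfl <;> simp [stdZ] <;> ring
  rw [e, ← hkey]
  exact mul_nonneg_iff_of_pos_left (by positivity)

lemma sign_stdX {α : ℝ} (hα : α ∈ Ioo 0 (Real.pi / 2)) {s : ℝ × ℝ} (hs : s ∈ stdRect α)
    {η : ℝ} (hη : η = 1 ∨ η = -1) : 0 ≤ η * stdX α s ↔ 0 ≤ η * s.1 := by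
  have hS := sin_pos_of_mem hα
  have hC := cos_pos_of_mem hα
  obtain ⟨⟨h1, h2⟩, h3, h4⟩ := hs
  have hc : 0 < Real.cos s.2 := Real.cos_pos_of_mem_Ioo ⟨by linarith [hα.1], by linarith [hα.1]⟩
  have hkey : 0 ≤ Real.sin (η * s.1) ↔ 0 ≤ η * s.1 := by
    apply sin_nonneg_iff_of_mem_Icc
    rcases hη with rfl | rfl <;> constructor <;> linarith [hα.2]
  have e : η * stdX α s = Real.cos s.2 / (Real.sin α * Real.cos α) * Real.sin (η * s.1) := by
    rcases hη with rfl | rfl <;> simp [stdX] <;> ring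
  rw [e, ← hkey]
  exact mul_nonneg_iff_of_pos_left (by positivity)

lemma eq_of_sq_eq_of_sign {η x y : ℝ} (hη : η = 1 ∨ η = -1) (hx : 0 ≤ η * x) (hy : 0 ≤ η * y)
    (h : x ^ 2 = y ^ 2) : x = y := by
  rcases sq_eq_sq_iff_eq_or_eq_neg.1 h with h | h
  · exact h
  · rcases hη with rfl | rfl <;> linarith

/-- At `s₃ = 0` only `X` and `Y` remain visible. They determine `Z²` through the ellipsoid equation,
and the half of the rectangle determines the sign of `Z`. -/
lemma bijOn_flat_xy {a b c : ℝ} (hab : b < a) (hbc : c < b) {ε η : ℝ}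
    (hε : ε = 1 ∨ ε = -1) (hη : η = 1 ∨ η = -1) :
    BijOn (stdParam (s₁Max a b c) ε 0) (stdRect (s₁Max a b c) ∩ {s | 0 ≤ η * s.2})
      (ellipsoidFamily a b c 0 ∩ halfSpace ε) := by
  have hα := s₁Max_mem hab hbc
  have hS := sin_pos_of_mem hα
  have hη2 : η ^ 2 = 1 := by rcases hη with rfl | rfl <;> norm_num
  have hε0 : ε ≠ 0 := by rcases hε with rfl | rfl <;> norm_num
  refine ⟨(stdParam_mapsTo hab hbc 0 hε).mono_left inter_subset_left, ?_, ?_⟩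
  · rintro s ⟨hs, hs'⟩ t ⟨ht, ht'⟩ h
    rw [E3.ext_iff] at h
    simp only [(stdParam_apply _ ε 0 _).1, (stdParam_apply _ ε 0 _).2.1, Real.cos_zero,
      mul_one] at h
    have hY := mul_left_cancel₀ hε0 h.2.1
    have o1 := onStd_of_mem_stdRect hα hs
    have o2 := onStd_of_mem_stdRect hα ht
    refine stdX_stdZ_injOn hα hs ht h.1 (eq_of_sq_eq_of_sign hη ((sign_stdZ hα hs hη).2 hs')
      ((sign_stdZ hα ht hη).2 ht') ?_)
    unfold OnStd at o1 o2
    rw [h.1, hY] at o1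
    exact mul_left_cancel₀ (pow_pos hS 2).ne' (by linarith)
  · rintro p ⟨hp, hp'⟩
    obtain ⟨X, Z, h, h0, h2⟩ := (mem_ellipsoidFamily_iff hab hbc 0 p).1 hp
    -- Reflecting `Z` to the prescribed sheet does not change the image point, since `sin 0 = 0`.
    have h' : OnStd (s₁Max a b c) X (p 1) (η * |Z|) := by
      unfold OnStd at h ⊢; rw [mul_pow, hη2, sq_abs, one_mul]; exact h
    obtain ⟨s, hs, -, hZ, h⟩ := exists_stdParam_eq hα hε h' h0 (by simpa using h2) hp'
    refine ⟨s, ⟨hs, (sign_stdZ hα hs hη).1 ?_⟩, h⟩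
    rw [hZ, ← mul_assoc, ← sq, hη2, one_mul]
    exact abs_nonneg _

lemma bijOn_flat_yz {a b c : ℝ} (hab : b < a) (hbc : c < b) {ε η : ℝ}
    (hε : ε = 1 ∨ ε = -1) (hη : η = 1 ∨ η = -1) :
    BijOn (stdParam (s₁Max a b c) ε (Real.pi / 2)) (stdRect (s₁Max a b c) ∩ {s | 0 ≤ η * s.1})
      (ellipsoidFamily a b c (Real.pi / 2) ∩ halfSpace ε) := by
  have hα := s₁Max_mem hab hbc
  have hC := cos_pos_of_mem hα
  have hη2 : η ^ 2 = 1 := by rcases hη with rfl | rfl <;> norm_num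
  have hε0 : ε ≠ 0 := by rcases hε with rfl | rfl <;> norm_num
  refine ⟨(stdParam_mapsTo hab hbc _ hε).mono_left inter_subset_left, ?_, ?_⟩
  · rintro s ⟨hs, hs'⟩ t ⟨ht, ht'⟩ h
    rw [E3.ext_iff] at h
    simp only [(stdParam_apply _ ε (Real.pi / 2) _).2.2, (stdParam_apply _ ε (Real.pi / 2) _).2.1,
      Real.sin_pi_div_two, mul_one] at h
    have hY := mul_left_cancel₀ hε0 h.2.1
    have o1 := onStd_of_mem_stdRect hα hs
    have o2 := onStd_of_mem_stdRect hα ht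
    refine stdX_stdZ_injOn hα hs ht (eq_of_sq_eq_of_sign hη ((sign_stdX hα hs hη).2 hs')
      ((sign_stdX hα ht hη).2 ht') ?_) h.2.2
    unfold OnStd at o1 o2
    rw [h.2.2, hY] at o1
    exact mul_left_cancel₀ (pow_pos hC 2).ne' (by linarith)
  · rintro p ⟨hp, hp'⟩
    obtain ⟨X, Z, h, h0, h2⟩ := (mem_ellipsoidFamily_iff hab hbc _ p).1 hp
    have h' : OnStd (s₁Max a b c) (η * |X|) (p 1) Z := by
      unfold OnStd at h ⊢; rw [mul_pow, hη2, sq_abs, one_mul]; exact h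
    obtain ⟨s, hs, hX, -, h⟩ := exists_stdParam_eq hα hε h' (by simpa using h0) h2 hp'
    refine ⟨s, ⟨hs, (sign_stdX hα hs hη).1 ?_⟩, h⟩
    rw [hX, ← mul_assoc, ← sq, hη2, one_mul]
    exact abs_nonneg _

/-! ### Planar members, Hausdorff limits and the unit sphere. -/

lemma ellipsoidFamily_subset_xy_iff {a b c : ℝ} (hab : b < a) (hbc : c < b) (θ : ℝ) :
    ellipsoidFamily a b c θ ⊆ {p | p 2 = 0} ↔ Real.sin θ = 0 := by
  have hS := sin_pos_of_mem (s₁Max_mem hab hbc)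
  constructor
  · intro h
    -- The image of the vertex of the standard ellipsoid on the `Z` axis.
    have : (!₂[0, 0, 1 / Real.sin (s₁Max a b c) * Real.sin θ] : E3) ∈ ellipsoidFamily a b c θ := by
      rw [mem_ellipsoidFamily_iff hab hbc]
      refine ⟨0, 1 / Real.sin (s₁Max a b c), ?_, ?_, ?_⟩ <;> simp [OnStd, hS.ne']
    have := h this
    simpa [hS.ne'] using this
  · intro h p hp
    obtain ⟨X, Z, -, -, h2⟩ := (mem_ellipsoidFamily_iff hab hbc θ p).1 hp
    simp [h2, h]

lemma ellipsoidFamily_subset_yz_iff {a b c : ℝ} (hab : b < a) (hbc : c < b) (θ : ℝ) :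
    ellipsoidFamily a b c θ ⊆ {p | p 0 = 0} ↔ Real.cos θ = 0 := by
  have hS := cos_pos_of_mem (s₁Max_mem hab hbc)
  constructor
  · intro h
    have : (!₂[1 / Real.cos (s₁Max a b c) * Real.cos θ, 0, 0] : E3) ∈ ellipsoidFamily a b c θ := by
      rw [mem_ellipsoidFamily_iff hab hbc]
      refine ⟨1 / Real.cos (s₁Max a b c), 0, ?_, ?_, ?_⟩ <;> simp [OnStd, hS.ne']
    have := h this
    simpa [hS.ne'] using this
  · intro h p hp
    obtain ⟨X, Z, -, h0, -⟩ := (mem_ellipsoidFamily_iff hab hbc θ p).1 hp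
    simp [h0, h]

/-- Points with the same `(X, Y, Z)` are compared. Since `|X| ≤ 1 / cos α` and `|Z| ≤ 1 / sin α`,
the bound is uniform in `p`, which controls the Hausdorff distance. -/
lemma exists_mem_ellipsoidFamily_dist_le {a b c : ℝ} (hab : b < a) (hbc : c < b) (θ τ : ℝ) {p : E3}
    (hp : p ∈ ellipsoidFamily a b c θ) : ∃ q ∈ ellipsoidFamily a b c τ,
      dist p q ≤ √((Real.cos θ - Real.cos τ) ^ 2 / Real.cos (s₁Max a b c) ^ 2
        + (Real.sin θ - Real.sin τ) ^ 2 / Real.sin (s₁Max a b c) ^ 2) := by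
  have hS := sin_pos_of_mem (s₁Max_mem hab hbc)
  have hC := cos_pos_of_mem (s₁Max_mem hab hbc)
  obtain ⟨X, Z, h, h0, h2⟩ := (mem_ellipsoidFamily_iff hab hbc θ p).1 hp
  refine ⟨!₂[X * Real.cos τ, p 1, Z * Real.sin τ],
    (mem_ellipsoidFamily_iff hab hbc τ _).2 ⟨X, Z, by simpa using h, by simp, by simp⟩, ?_⟩
  rw [EuclideanSpace.dist_eq]
  apply Real.sqrt_le_sqrt
  simp only [Fin.sum_univ_three, Real.dist_eq, sq_abs, h0, h2]
  simp only [Matrix.cons_val, sub_self]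
  unfold OnStd at h
  have hX : X ^ 2 ≤ 1 / Real.cos (s₁Max a b c) ^ 2 := by
    rw [le_div_iff₀ (by positivity)]
    nlinarith [sq_nonneg (p 1), sq_nonneg (Real.sin (s₁Max a b c) * Z)]
  have hZ : Z ^ 2 ≤ 1 / Real.sin (s₁Max a b c) ^ 2 := by
    rw [le_div_iff₀ (by positivity)]
    nlinarith [sq_nonneg (p 1), sq_nonneg (Real.cos (s₁Max a b c) * X)]
  have i1 := mul_le_mul_of_nonneg_left hX (sq_nonneg (Real.cos θ - Real.cos τ))
  have i2 := mul_le_mul_of_nonneg_left hZ (sq_nonneg (Real.sin θ - Real.sin τ))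
  rw [mul_one_div] at i1 i2
  nlinarith

lemma tendsto_hausdorffEDist_ellipsoidFamily {a b c : ℝ} (hab : b < a) (hbc : c < b) (τ : ℝ) :
    Tendsto (fun t => Metric.hausdorffEDist (ellipsoidFamily a b c t) (ellipsoidFamily a b c τ))
      (𝓝 τ) (𝓝 0) := by
  set d : ℝ → ℝ := fun t => √((Real.cos t - Real.cos τ) ^ 2 / Real.cos (s₁Max a b c) ^ 2
        + (Real.sin t - Real.sin τ) ^ 2 / Real.sin (s₁Max a b c) ^ 2) with hd
  have hcont : Continuous d := by fun_prop
  have h1 : Tendsto (fun t => ENNReal.ofReal (d t)) (𝓝 τ) (𝓝 0) := by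
    have := (ENNReal.continuous_ofReal.comp hcont).tendsto τ
    simpa [hd, Function.comp_def] using this
  refine tendsto_of_tendsto_of_tendsto_of_le_of_le tendsto_const_nhds h1
    (fun _ => zero_le) (fun t => ?_)
  apply Metric.hausdorffEDist_le_of_mem_edist
  · intro p hp
    obtain ⟨q, hq, h⟩ := exists_mem_ellipsoidFamily_dist_le hab hbc t τ hp
    exact ⟨q, hq, by rw [edist_dist]; exact ENNReal.ofReal_le_ofReal h⟩
  · intro p hp
    obtain ⟨q, hq, h⟩ := exists_mem_ellipsoidFamily_dist_le hab hbc τ t hp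
    refine ⟨q, hq, ?_⟩
    rw [edist_dist]
    apply ENNReal.ofReal_le_ofReal
    rw [hd]
    simpa only [← sub_sq_comm (Real.cos τ), ← sub_sq_comm (Real.sin τ)] using h

lemma tendsto_hausdorffEDist_ellipsoid {a b c : ℝ} (hab : b < a) (hbc : c < b) (τ : ℝ)
    (h : ∀ᶠ t in 𝓝[≠] τ, Real.sin t ≠ 0 ∧ Real.cos t ≠ 0) :
    Tendsto (fun t => Metric.hausdorffEDist (ellipsoid a b c t) (ellipsoidFamily a b c τ))
      (𝓝[≠] τ) (𝓝 0) := by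
  refine ((tendsto_hausdorffEDist_ellipsoidFamily hab hbc τ).mono_left nhdsWithin_le_nhds).congr' ?_
  filter_upwards [h] with t ht
  rw [ellipsoidFamily_eq_ellipsoid ht.1 ht.2]

/-- The tangent is that of `α`, so `cos² s₃` and `sin² s₃` cancel the coefficients of `x²` and `z²`.
-/
lemma ellipsoid_arctan_eq_sphere {a b c : ℝ} (hab : b < a) (hbc : c < b) :
    ellipsoid a b c (Real.arctan √((a - b) / (b - c))) = Metric.sphere (0 : E3) 1 := by
  have h1 : 0 < (a - b) / (b - c) := div_pos (by linarith) (by linarith)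
  have hc : Real.cos (Real.arctan √((a - b) / (b - c))) ^ 2 = (b - c) / (a - c) := by
    have h2 : b - c ≠ 0 := by linarith
    have h3 : a - c ≠ 0 := by linarith
    have h4 : 1 + (a - b) / (b - c) = (a - c) / (b - c) := by field_simp; ring
    rw [Real.cos_sq_arctan, Real.sq_sqrt h1.le, h4, one_div_div]
  have hs : Real.sin (Real.arctan √((a - b) / (b - c))) ^ 2 = (a - b) / (a - c) := by
    have h3 : a - c ≠ 0 := by linarith
    rw [Real.sin_sq, hc]
    field_simp
    ring
  ext p
  rw [ellipsoid, mem_ofPred_eq, hc, hs, mem_sphere_iff_norm, sub_zero,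
    ← sq_eq_sq₀ (norm_nonneg _) zero_le_one, EuclideanSpace.real_norm_sq_eq, Fin.sum_univ_three,
    mul_div_cancel₀, mul_div_cancel₀, one_pow]
  all_goals exact (div_pos (by linarith) (by linarith)).ne'

/-! ### Circular sections. -/

/-- The offset `κ` such that the curve `s₁ + δ s₂ = k` is the section of the standard ellipsoid
by the plane `X + δ Z = κ`. -/
def sectionOffset (α k : ℝ) : ℝ := Real.sin k / (Real.sin α * Real.cos α)

lemma stdX_add_stdZ_eq_iff {α δ k : ℝ} (hα : α ∈ Ioo 0 (Real.pi / 2)) (hδ : δ = 1 ∨ δ = -1)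
    (hk : k ∈ Icc (-(Real.pi / 2)) (Real.pi / 2)) {s : ℝ × ℝ} (hs : s ∈ stdRect α) :
    stdX α s + δ * stdZ α s = sectionOffset α k ↔ s.1 + δ * s.2 = k := by
  rw [stdX_add_stdZ α δ hδ, sectionOffset,
    div_left_inj' (mul_pos (sin_pos_of_mem hα) (cos_pos_of_mem hα)).ne']
  exact Real.injOn_sin.eq_iff (add_mem_Icc_of_mem_stdRect hs hδ) hk

/-- This removes the parameters and the two arcs: every point has `y ≥ 0` or `y ≤ 0`, so the arcs
together give the whole plane section. -/
lemma mem_diagCurve_iff {a b c : ℝ} (hab : b < a) (hbc : c < b) {δ k : ℝ}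
    (hδ : δ = 1 ∨ δ = -1) (hk : k ∈ Icc (-(Real.pi / 2)) (Real.pi / 2)) (θ : ℝ) (p : E3) :
    p ∈ diagCurve a b c δ k θ ↔ ∃ X Z, OnStd (s₁Max a b c) X (p 1) Z ∧
      X + δ * Z = sectionOffset (s₁Max a b c) k ∧
      p 0 = X * Real.cos θ ∧ p 2 = Z * Real.sin θ := by
  have hα := s₁Max_mem hab hbc
  have key : ∀ ε : ℝ, ε = 1 ∨ ε = -1 → (p ∈ param a b c ε θ '' diagLine a b c δ k ↔
      p ∈ halfSpace ε ∧ ∃ X Z, OnStd (s₁Max a b c) X (p 1) Z ∧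
      X + δ * Z = sectionOffset (s₁Max a b c) k ∧
      p 0 = X * Real.cos θ ∧ p 2 = Z * Real.sin θ) := by
    intro ε hε
    rw [param_eq_stdParam hab hbc]
    constructor
    · rintro ⟨s, ⟨hs, hsk⟩, rfl⟩
      obtain ⟨h0, h1, h2⟩ := stdParam_apply (s₁Max a b c) ε θ s
      refine ⟨(stdParam_mapsTo hab hbc θ hε hs).2, _, _, ?_,
        (stdX_add_stdZ_eq_iff hα hδ hk hs).2 hsk, h0, h2⟩
      rw [h1, onStd_mul_sign hε]
      exact onStd_of_mem_stdRect hα hs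
    · rintro ⟨hp, X, Z, h, hXZ, h0, h2⟩
      obtain ⟨s, hs, hX, hZ, h⟩ := exists_stdParam_eq hα hε h h0 h2 hp
      refine ⟨s, ⟨hs, (stdX_add_stdZ_eq_iff hα hδ hk hs).1 ?_⟩, h⟩
      rw [hX, hZ, hXZ]
  rw [diagCurve, mem_union, key 1 (Or.inl rfl), key (-1) (Or.inr rfl), ← or_and_right]
  refine and_iff_right ?_
  rcases le_total 0 (p 1) with h | h
  · exact Or.inl (by simpa [halfSpace] using h)
  · exact Or.inr (by simpa [halfSpace] using h)

/-- The centre of the circle `s₁ + δ s₂ = k`. -/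
def circleCenter (α δ k θ : ℝ) : E3 :=
  !₂[Real.sin α ^ 2 * sectionOffset α k * Real.cos θ, 0,
    δ * (Real.cos α ^ 2 * sectionOffset α k) * Real.sin θ]

/-- A unit normal of the plane of the circle `s₁ + δ s₂ = k`. -/
def circleNormal (δ θ : ℝ) : E3 := !₂[Real.sin θ, 0, δ * Real.cos θ]

/-- The plane of the circle `s₁ + δ s₂ = k`. -/
def circlePlane (α δ k θ : ℝ) : AffineSubspace ℝ E3 :=
  AffineSubspace.mk' (circleCenter α δ k θ) (Submodule.span ℝ {circleNormal δ θ})ᗮ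

lemma mem_circlePlane_iff {δ : ℝ} (hδ : δ = 1 ∨ δ = -1) (α k θ : ℝ) (p : E3) :
    p ∈ circlePlane α δ k θ ↔
      Real.sin θ * p 0 + δ * Real.cos θ * p 2
        = sectionOffset α k * (Real.sin θ * Real.cos θ) := by
  have hδ2 : δ ^ 2 = 1 := by rcases hδ with rfl | rfl <;> norm_num
  have hα := Real.sin_sq_add_cos_sq α
  rw [circlePlane, AffineSubspace.mem_mk', Submodule.mem_orthogonal_singleton_iff_inner_right,
    vsub_eq_sub, PiLp.inner_apply, Fin.sum_univ_three]
  simp only [circleNormal, circleCenter, PiLp.sub_apply, Matrix.cons_val,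
    RCLike.inner_apply, conj_trivial]
  rw [← sub_eq_zero (a := Real.sin θ * p 0 + δ * Real.cos θ * p 2)]
  have : (p 0 - Real.sin α ^ 2 * sectionOffset α k * Real.cos θ) * Real.sin θ + (p 1 - 0) * 0
      + (p 2 - δ * (Real.cos α ^ 2 * sectionOffset α k) * Real.sin θ) * (δ * Real.cos θ)
      = Real.sin θ * p 0 + δ * Real.cos θ * p 2
        - sectionOffset α k * (Real.sin θ * Real.cos θ) := by
    linear_combination (-sectionOffset α k * Real.sin θ * Real.cos θ) * hα
      - (Real.cos α ^ 2 * sectionOffset α k * Real.sin θ * Real.cos θ) * hδ2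
  rw [this]

lemma finrank_circlePlane_direction {δ : ℝ} (hδ : δ = 1 ∨ δ = -1) (α k θ : ℝ) :
    Module.finrank ℝ (circlePlane α δ k θ).direction = 2 := by
  have : Fact (Module.finrank ℝ E3 = 2 + 1) := ⟨by simp⟩
  rw [circlePlane, AffineSubspace.direction_mk']
  apply Submodule.finrank_orthogonal_span_singleton
  intro h
  have h0 : Real.sin θ = 0 := congrArg (fun p : E3 => p 0) h
  have h2 : δ * Real.cos θ = 0 := congrArg (fun p : E3 => p 2) h
  have hθ := Real.sin_sq_add_cos_sq θ
  rcases hδ with rfl | rfl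
  · rw [h0, (by linarith : Real.cos θ = 0)] at hθ; norm_num at hθ
  · rw [h0, (by linarith : Real.cos θ = 0)] at hθ; norm_num at hθ

/-- Completing the square in the section leaves the radius squared `1 - sin² α cos² α κ²`; this
identifies it as `cos² k`. -/
lemma sin_mul_cos_mul_sectionOffset {α : ℝ} (hα : α ∈ Ioo 0 (Real.pi / 2)) (k : ℝ) :
    Real.sin α ^ 2 * Real.cos α ^ 2 * sectionOffset α k ^ 2 = 1 - Real.cos k ^ 2 := by
  have hS := sin_pos_of_mem hα
  have hC := cos_pos_of_mem hα
  rw [sectionOffset, ← Real.sin_sq]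
  field_simp

lemma isCircleInPlane_diagCurve {a b c : ℝ} (hab : b < a) (hbc : c < b) {δ k : ℝ}
    (hδ : δ = 1 ∨ δ = -1) (hk : k ∈ Icc (-(Real.pi / 2)) (Real.pi / 2)) (θ : ℝ) :
    IsCircleInPlane (circlePlane (s₁Max a b c) δ k θ) (Real.cos k) (diagCurve a b c δ k θ) := by
  refine ⟨finrank_circlePlane_direction hδ _ _ _, circleCenter (s₁Max a b c) δ k θ,
    AffineSubspace.self_mem_mk' _ _, ?_⟩
  have hδ2 : δ ^ 2 = 1 := by rcases hδ with rfl | rfl <;> norm_num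
  have hα := Real.sin_sq_add_cos_sq (s₁Max a b c)
  have hθ := Real.sin_sq_add_cos_sq θ
  have hκ := sin_mul_cos_mul_sectionOffset (s₁Max_mem hab hbc) k
  have hk0 : 0 ≤ Real.cos k := Real.cos_nonneg_of_mem_Icc hk
  ext p
  rw [mem_inter_iff, SetLike.mem_coe, mem_circlePlane_iff hδ, mem_sphere_iff_norm,
    ← sq_eq_sq₀ (norm_nonneg _) hk0, EuclideanSpace.real_norm_sq_eq, Fin.sum_univ_three,
    mem_diagCurve_iff hab hbc hδ hk]
  simp only [circleCenter, PiLp.sub_apply, Matrix.cons_val, OnStd]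
  generalize sectionOffset (s₁Max a b c) k = κ at *
  set S := Real.sin (s₁Max a b c)
  set C := Real.cos (s₁Max a b c)
  constructor
  · rintro ⟨X, Z, h, hXZ, h0, h2⟩
    rw [h0, h2]
    have hZ : Z = δ * (κ - X) := by linear_combination (-Z) * hδ2 + δ * hXZ
    refine ⟨by linear_combination Real.sin θ * Real.cos θ * hXZ, ?_⟩
    subst hZ
    have hC2 : C ^ 2 = 1 - S ^ 2 := by linarith
    rw [hC2] at h hκ ⊢
    linear_combination h - hκ + (X - S ^ 2 * κ) ^ 2 * hθ
      + ((X - S ^ 2 * κ) ^ 2 * Real.sin θ ^ 2 - S ^ 2 * (κ - X) ^ 2) * hδ2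
  · rintro ⟨hP, hS⟩
    -- `X` is recovered as a coordinate within the plane, without dividing by `cos θ` or `sin θ`, so
    -- the flat cases are included.
    have h0 : p 0 = (Real.cos θ * p 0 - δ * Real.sin θ * p 2 + κ * Real.sin θ ^ 2)
        * Real.cos θ := by
      linear_combination (-p 0) * hθ + Real.sin θ * hP
    have h2 : p 2 = δ * (κ - (Real.cos θ * p 0 - δ * Real.sin θ * p 2 + κ * Real.sin θ ^ 2))
        * Real.sin θ := by
      linear_combination (-p 2 * δ ^ 2 + δ * κ * Real.sin θ) * hθ + δ * Real.cos θ * hP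
        - p 2 * hδ2
    set X := Real.cos θ * p 0 - δ * Real.sin θ * p 2 + κ * Real.sin θ ^ 2
    refine ⟨X, δ * (κ - X), ?_, by linear_combination (κ - X) * hδ2, h0, h2⟩
    rw [h0, h2] at hS
    have hC2 : C ^ 2 = 1 - S ^ 2 := by linarith
    rw [hC2] at hS hκ ⊢
    linear_combination hS + hκ - (X - S ^ 2 * κ) ^ 2 * hθ
      - ((X - S ^ 2 * κ) ^ 2 * Real.sin θ ^ 2 - S ^ 2 * (κ - X) ^ 2) * hδ2

lemma diagCurve_eq_inter {a b c : ℝ} (hab : b < a) (hbc : c < b) {δ k : ℝ}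
    (hδ : δ = 1 ∨ δ = -1) (hk : k ∈ Icc (-(Real.pi / 2)) (Real.pi / 2)) {θ : ℝ}
    (h1 : Real.sin θ ≠ 0) (h2 : Real.cos θ ≠ 0) :
    diagCurve a b c δ k θ
      = ellipsoid a b c θ ∩ (circlePlane (s₁Max a b c) δ k θ : Set E3) := by
  ext p
  rw [← ellipsoidFamily_eq_ellipsoid h1 h2, mem_inter_iff, mem_ellipsoidFamily_iff hab hbc,
    SetLike.mem_coe, mem_circlePlane_iff hδ, mem_diagCurve_iff hab hbc hδ hk]
  -- The two plane equations differ by the factor `sin θ cos θ`. When it vanishes, the plane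
  -- contains the whole disc and the equivalence fails.
  have key : ∀ X Z : ℝ, X + δ * Z = sectionOffset (s₁Max a b c) k ↔
      Real.sin θ * (X * Real.cos θ) + δ * Real.cos θ * (Z * Real.sin θ)
        = sectionOffset (s₁Max a b c) k * (Real.sin θ * Real.cos θ) := by
    intro X Z
    rw [← mul_left_inj' (mul_ne_zero h1 h2)]
    ring_nf
  constructor
  · rintro ⟨X, Z, h, hXZ, h0, h2⟩
    exact ⟨⟨X, Z, h, h0, h2⟩, by rw [h0, h2]; exact (key X Z).1 hXZ⟩
  · rintro ⟨⟨X, Z, h, h0, h2⟩, hP⟩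
    rw [h0, h2] at hP
    exact ⟨X, Z, h, (key X Z).2 hP, h0, h2⟩

/-! ### Congruence of corresponding circles. -/

/-- A congruence that maps the plane of the circle `s₁ + δ s₂ = k` to the plane `z = 0`, so that
points on the circle have coordinates independent of `s₃`. -/
def flatten (δ κ θ : ℝ) (hδ : δ = 1 ∨ δ = -1) : E3 ≃ᵢ E3 :=
  IsometryEquiv.mk'
    (fun p => !₂[Real.cos θ * p 0 - δ * Real.sin θ * p 2 + κ * Real.sin θ ^ 2, p 1,
      Real.sin θ * p 0 + δ * Real.cos θ * p 2 - κ * (Real.sin θ * Real.cos θ)])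
    (fun q => !₂[Real.cos θ * q 0 + Real.sin θ * q 2, q 1,
      δ * (Real.sin θ * (κ - q 0) + Real.cos θ * q 2)])
    (fun q => by
      have hδ2 : δ ^ 2 = 1 := by rcases hδ with rfl | rfl <;> norm_num
      have hθ := Real.sin_sq_add_cos_sq θ
      rw [E3.ext_iff]
      simp only [Matrix.cons_val]
      refine ⟨?_, trivial, ?_⟩
      · linear_combination q 0 * hθ
          - Real.sin θ * (Real.sin θ * (κ - q 0) + Real.cos θ * q 2) * hδ2
      · linear_combination q 2 * hθ
          + Real.cos θ * (Real.sin θ * (κ - q 0) + Real.cos θ * q 2) * hδ2)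
    (Isometry.of_dist_eq fun p q => by
      have hδ2 : δ ^ 2 = 1 := by rcases hδ with rfl | rfl <;> norm_num
      have hθ := Real.sin_sq_add_cos_sq θ
      rw [EuclideanSpace.dist_eq, EuclideanSpace.dist_eq]
      congr 1
      simp only [Fin.sum_univ_three, Real.dist_eq, sq_abs]
      simp only [Matrix.cons_val]
      linear_combination ((p 0 - q 0) ^ 2 + δ ^ 2 * (p 2 - q 2) ^ 2) * hθ
        + (p 2 - q 2) ^ 2 * hδ2)

lemma flatten_apply (δ κ θ : ℝ) (hδ : δ = 1 ∨ δ = -1) (p : E3) : flatten δ κ θ hδ p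
    = !₂[Real.cos θ * p 0 - δ * Real.sin θ * p 2 + κ * Real.sin θ ^ 2, p 1,
      Real.sin θ * p 0 + δ * Real.cos θ * p 2 - κ * (Real.sin θ * Real.cos θ)] := rfl

/-- With `δ Z = κ - X`, the shift `κ sin² θ` makes the first coordinate exactly `X`. The right side
is free of `θ`, so flattening at `θ` and unflattening at `θ'` is the desired congruence. -/
lemma flatten_stdParam {α δ κ : ℝ} (hδ : δ = 1 ∨ δ = -1) (ε θ : ℝ) {s : ℝ × ℝ}
    (h : stdX α s + δ * stdZ α s = κ) :
    flatten δ κ θ hδ (stdParam α ε θ s) = !₂[stdX α s, ε * stdY α s, 0] := by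
  have hθ := Real.sin_sq_add_cos_sq θ
  obtain ⟨h0, h1, h2⟩ := stdParam_apply α ε θ s
  rw [flatten_apply, h0, h1, h2, E3.ext_iff]
  simp only [Matrix.cons_val]
  refine ⟨?_, trivial, ?_⟩
  · linear_combination stdX α s * hθ - Real.sin θ ^ 2 * h
  · linear_combination Real.sin θ * Real.cos θ * h

lemma exists_congruence_diagCurve {a b c : ℝ} (hab : b < a) (hbc : c < b) {δ k : ℝ}
    (hδ : δ = 1 ∨ δ = -1) (hk : k ∈ Icc (-(Real.pi / 2)) (Real.pi / 2)) (θ θ' : ℝ) :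
    ∃ φ : E3 ≃ᵢ E3, φ '' diagCurve a b c δ k θ = diagCurve a b c δ k θ' ∧
      ∀ ε : ℝ, ∀ s ∈ diagLine a b c δ k, φ (param a b c ε θ s) = param a b c ε θ' s := by
  set κ := sectionOffset (s₁Max a b c) k
  let φ : E3 ≃ᵢ E3 := (flatten δ κ θ hδ).trans (flatten δ κ θ' hδ).symm
  have key : ∀ ε : ℝ, ∀ s ∈ diagLine a b c δ k,
      φ (param a b c ε θ s) = param a b c ε θ' s := by
    rintro ε s ⟨hs, hsk⟩
    have h := (stdX_add_stdZ_eq_iff (s₁Max_mem hab hbc) hδ hk hs).2 hsk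
    rw [param_eq_stdParam hab hbc, param_eq_stdParam hab hbc, IsometryEquiv.trans_apply,
      IsometryEquiv.symm_apply_eq, flatten_stdParam hδ ε θ h, flatten_stdParam hδ ε θ' h]
  refine ⟨φ, ?_, key⟩
  rw [diagCurve, diagCurve, image_union, image_image, image_image,
    image_congr (key 1), image_congr (key (-1))]

/-! ### One-variable derivatives of the factors of the unit normal. -/

/-- The function of one parameter whose product with its counterpart in the other parameter is
the squared norm of the gradient normal. -/
def normFactor (S C c t : ℝ) : ℝ := S ^ 2 * c ^ 2 + (C ^ 2 - c ^ 2) * Real.sin t ^ 2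

lemma hasDerivAt_sqrt_normFactor {S C c t : ℝ} (h : 0 < normFactor S C c t) :
    HasDerivAt (fun t => √(normFactor S C c t))
      ((C ^ 2 - c ^ 2) * Real.sin t * Real.cos t / √(normFactor S C c t)) t := by
  have h1 : HasDerivAt (normFactor S C c)
      ((C ^ 2 - c ^ 2) * (2 * Real.sin t * Real.cos t)) t := by
    have := (((Real.hasDerivAt_sin t).pow 2).const_mul (C ^ 2 - c ^ 2)).const_add (S ^ 2 * c ^ 2)
    change HasDerivAt (fun t => S ^ 2 * c ^ 2 + (C ^ 2 - c ^ 2) * Real.sin t ^ 2) _ t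
    simpa using this
  convert h1.sqrt h.ne' using 1
  have := Real.sqrt_pos.2 h
  field_simp

/-- Normalizing leaves a constant times the derivative of the numerator, over the cube of the root.
The same happens for cosine and for `√(S² - sin² t)`, with constants that match across the three
components of the normal; this is the source of the Rodrigues equations. -/
lemma hasDerivAt_sin_div {S C c t : ℝ} (h : 0 < normFactor S C c t) :
    HasDerivAt (fun t => Real.sin t / √(normFactor S C c t))
      (S ^ 2 * c ^ 2 * Real.cos t / √(normFactor S C c t) ^ 3) t := by
  have hD := Real.sqrt_pos.2 h
  have hD2 := Real.sq_sqrt h.le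
  refine ((Real.hasDerivAt_sin t).fun_div (hasDerivAt_sqrt_normFactor h) hD.ne').congr_deriv ?_
  set D := √(normFactor S C c t)
  rw [normFactor] at hD2
  field_simp
  rw [hD2]
  ring

lemma hasDerivAt_cos_div {S C c s t : ℝ} (h : 0 < normFactor S C c t) (hSC : S ^ 2 + C ^ 2 = 1)
    (hcs : c ^ 2 + s ^ 2 = 1) :
    HasDerivAt (fun t => Real.cos t / √(normFactor S C c t))
      (-(C ^ 2 * s ^ 2 * Real.sin t) / √(normFactor S C c t) ^ 3) t := by
  have hD := Real.sqrt_pos.2 h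
  have hD2 := Real.sq_sqrt h.le
  have ht := Real.cos_sq' t
  refine ((Real.hasDerivAt_cos t).fun_div (hasDerivAt_sqrt_normFactor h) hD.ne').congr_deriv ?_
  set D := √(normFactor S C c t)
  rw [normFactor] at hD2
  field_simp
  rw [hD2, ht]
  have h1 : S ^ 2 = 1 - C ^ 2 := by linarith
  have h2 : s ^ 2 = 1 - c ^ 2 := by linarith
  rw [h1, h2]
  ring

lemma hasDerivAt_sqrt_sub {S t : ℝ} (hA : 0 < S ^ 2 - Real.sin t ^ 2) :
    HasDerivAt (fun t => √(S ^ 2 - Real.sin t ^ 2))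
      (-(Real.sin t * Real.cos t) / √(S ^ 2 - Real.sin t ^ 2)) t := by
  have h1 : HasDerivAt (fun t => S ^ 2 - Real.sin t ^ 2) (-(2 * Real.sin t * Real.cos t)) t := by
    have := ((Real.hasDerivAt_sin t).pow 2).const_sub (S ^ 2)
    simpa using this
  convert h1.sqrt hA.ne' using 1
  have := Real.sqrt_pos.2 hA
  field_simp

lemma hasDerivAt_sqrt_sub_div {S C c t : ℝ} (h : 0 < normFactor S C c t)
    (hA : 0 < S ^ 2 - Real.sin t ^ 2) :
    HasDerivAt (fun t => √(S ^ 2 - Real.sin t ^ 2) / √(normFactor S C c t))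
      (-(S ^ 2 * C ^ 2 * Real.sin t * Real.cos t) /
        (√(S ^ 2 - Real.sin t ^ 2) * √(normFactor S C c t) ^ 3)) t := by
  have hD := Real.sqrt_pos.2 h
  have hD2 := Real.sq_sqrt h.le
  have hA1 := Real.sqrt_pos.2 hA
  have hA2 := Real.sq_sqrt hA.le
  refine ((hasDerivAt_sqrt_sub hA).fun_div (hasDerivAt_sqrt_normFactor h) hD.ne').congr_deriv ?_
  set D := √(normFactor S C c t)
  set A := √(S ^ 2 - Real.sin t ^ 2)
  rw [normFactor] at hD2
  field_simp
  rw [hD2, hA2]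
  ring

/-- Regrouped as `c² (S² - sin² t) + C² sin² t`, the factor can vanish only if `c = 0` and `sin t =
0`: exactly on the fold of a flat member. -/
lemma normFactor_pos {S C c t : ℝ} (hA : 0 < S ^ 2 - Real.sin t ^ 2) (hC : 0 < C)
    (h : c ≠ 0 ∨ Real.sin t ≠ 0) : 0 < normFactor S C c t := by
  have e : normFactor S C c t
      = c ^ 2 * (S ^ 2 - Real.sin t ^ 2) + C ^ 2 * Real.sin t ^ 2 := by
    rw [normFactor]; ring
  rw [e]
  rcases h with h | h
  · have := sq_nonneg (C * Real.sin t)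
    have := mul_pos (pow_pos (abs_pos.2 h) 2) hA
    rw [sq_abs] at this
    linarith [mul_pow C (Real.sin t) 2]
  · have := mul_nonneg (sq_nonneg c) hA.le
    have := mul_pos (pow_pos hC 2) (pow_pos (abs_pos.2 h) 2)
    rw [sq_abs] at this
    linarith

/-! ### Partial derivatives of the parametrization. -/

lemma fderiv_apply_one_zero {f : ℝ × ℝ → E3} {p : ℝ × ℝ} (hf : DifferentiableAt ℝ f p) {i : Fin 3}
    {g : ℝ} (h : HasDerivAt (fun t => f (t, p.2) i) g p.1) : fderiv ℝ f p (1, 0) i = g := by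
  have h1 : HasDerivAt (fun t : ℝ => (t, p.2)) (1, 0) p.1 :=
    (hasDerivAt_id p.1).prodMk (hasDerivAt_const p.1 p.2)
  have h2 := HasFDerivAt.comp_hasDerivAt p.1 (f := fun t : ℝ => (t, p.2)) hf.hasFDerivAt h1
  have h3 := (EuclideanSpace.proj (𝕜 := ℝ) i).hasFDerivAt.comp_hasDerivAt p.1 h2
  exact h3.unique h

lemma fderiv_apply_zero_one {f : ℝ × ℝ → E3} {p : ℝ × ℝ} (hf : DifferentiableAt ℝ f p) {i : Fin 3}
    {g : ℝ} (h : HasDerivAt (fun t => f (p.1, t) i) g p.2) : fderiv ℝ f p (0, 1) i = g := by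
  have h1 : HasDerivAt (fun t : ℝ => (p.1, t)) (0, 1) p.2 :=
    (hasDerivAt_const p.2 p.1).prodMk (hasDerivAt_id p.2)
  have h2 := HasFDerivAt.comp_hasDerivAt p.2 (f := fun t : ℝ => (p.1, t)) hf.hasFDerivAt h1
  have h3 := (EuclideanSpace.proj (𝕜 := ℝ) i).hasFDerivAt.comp_hasDerivAt p.2 h2
  exact h3.unique h

lemma clm_prod_apply (L : ℝ × ℝ →L[ℝ] E3) (v : ℝ × ℝ) :
    L v = v.1 • L (1, 0) + v.2 • L (0, 1) := by
  rw [← map_smul, ← map_smul, ← map_add]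
  simp

lemma injective_of_inner_eq_zero {L : ℝ × ℝ →L[ℝ] E3} (h : inner ℝ (L (1, 0)) (L (0, 1)) = 0)
    (h1 : L (1, 0) ≠ 0) (h2 : L (0, 1) ≠ 0) : Function.Injective L := by
  rw [injective_iff_map_eq_zero]
  intro v hv
  rw [clm_prod_apply] at hv
  have e1 : inner ℝ (L (1, 0)) (v.1 • L (1, 0) + v.2 • L (0, 1)) = 0 := by rw [hv, inner_zero_right]
  have e2 : inner ℝ (L (0, 1)) (v.1 • L (1, 0) + v.2 • L (0, 1)) = 0 := by rw [hv, inner_zero_right]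
  rw [inner_add_right, inner_smul_right, inner_smul_right] at e1 e2
  rw [h, mul_zero, add_zero] at e1
  rw [real_inner_comm, h, mul_zero, zero_add] at e2
  ext
  · exact (mul_eq_zero.1 e1).resolve_right (inner_self_ne_zero.2 h1)
  · exact (mul_eq_zero.1 e2).resolve_right (inner_self_ne_zero.2 h2)

lemma exists_neg_smul {x y : E3} {k : ℝ} (h : x = k • y) : ∃ κ : ℝ, x = -κ • y :=
  ⟨-k, by rw [neg_neg, h]⟩

/-- The unit normal of the parametrized surface; it also makes sense for the flat discs. -/
def stdNormal (α ε θ : ℝ) (s : ℝ × ℝ) : E3 :=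
  !₂[Real.cos α ^ 2 * Real.sin θ
      * (Real.sin s.1 / √(normFactor (Real.sin α) (Real.cos α) (Real.cos θ) s.1))
      * (Real.cos s.2 / √(normFactor (Real.cos α) (Real.sin α) (Real.sin θ) s.2)),
    ε * Real.cos θ * Real.sin θ * (√(Real.sin α ^ 2 - Real.sin s.1 ^ 2)
        / √(normFactor (Real.sin α) (Real.cos α) (Real.cos θ) s.1))
      * (√(Real.cos α ^ 2 - Real.sin s.2 ^ 2)
        / √(normFactor (Real.cos α) (Real.sin α) (Real.sin θ) s.2)),
    Real.sin α ^ 2 * Real.cos θ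
      * (Real.cos s.1 / √(normFactor (Real.sin α) (Real.cos α) (Real.cos θ) s.1))
      * (Real.sin s.2 / √(normFactor (Real.cos α) (Real.sin α) (Real.sin θ) s.2))]

lemma contDiffAt_stdParam {α ε θ : ℝ} {s : ℝ × ℝ} (hA : 0 < Real.sin α ^ 2 - Real.sin s.1 ^ 2)
    (hB : 0 < Real.cos α ^ 2 - Real.sin s.2 ^ 2) : ContDiffAt ℝ ∞ (stdParam α ε θ) s := by
  have hA' := hA.ne'
  have hB' := hB.ne'
  rw [contDiffAt_euclidean]
  intro i
  fin_cases i <;> simp [stdParam, stdX, stdY, stdZ] <;> fun_prop (disch := assumption)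

lemma contDiffAt_stdNormal {α ε θ : ℝ} {s : ℝ × ℝ} (hA : 0 < Real.sin α ^ 2 - Real.sin s.1 ^ 2)
    (hB : 0 < Real.cos α ^ 2 - Real.sin s.2 ^ 2)
    (hP : 0 < normFactor (Real.sin α) (Real.cos α) (Real.cos θ) s.1)
    (hQ : 0 < normFactor (Real.cos α) (Real.sin α) (Real.sin θ) s.2) :
    ContDiffAt ℝ ∞ (stdNormal α ε θ) s := by
  have hA' := hA.ne'
  have hB' := hB.ne'
  have hP' := hP.ne'
  have hQ' := hQ.ne'
  have hP'' := (Real.sqrt_pos.2 hP).ne'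
  have hQ'' := (Real.sqrt_pos.2 hQ).ne'
  unfold normFactor at hP' hQ' hP'' hQ''
  rw [contDiffAt_euclidean]
  intro i
  fin_cases i <;> simp [stdNormal, normFactor] <;> fun_prop (disch := assumption)

lemma fderiv_stdParam_one_zero {α ε θ : ℝ} {s : ℝ × ℝ}
    (hA : 0 < Real.sin α ^ 2 - Real.sin s.1 ^ 2)
    (hB : 0 < Real.cos α ^ 2 - Real.sin s.2 ^ 2) :
    fderiv ℝ (stdParam α ε θ) s (1, 0) = (Real.sin α * Real.cos α)⁻¹ •
      !₂[Real.cos s.1 * Real.cos s.2 * Real.cos θ,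
        -ε * (Real.sin s.1 * Real.cos s.1 / √(Real.sin α ^ 2 - Real.sin s.1 ^ 2))
          * √(Real.cos α ^ 2 - Real.sin s.2 ^ 2),
        -(Real.sin s.1 * Real.sin s.2 * Real.sin θ)] := by
  have hd := (contDiffAt_stdParam (ε := ε) (θ := θ) hA hB).differentiableAt (by simp)
  have e0 := fderiv_apply_one_zero hd (i := 0) ((((Real.hasDerivAt_sin s.1).mul_const
    (Real.cos s.2)).div_const (Real.sin α * Real.cos α)).mul_const (Real.cos θ))
  have e1 := fderiv_apply_one_zero hd (i := 1) ((((hasDerivAt_sqrt_sub hA).mul_const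
    √(Real.cos α ^ 2 - Real.sin s.2 ^ 2)).div_const (Real.sin α * Real.cos α)).const_mul ε)
  have e2 := fderiv_apply_one_zero hd (i := 2) ((((Real.hasDerivAt_cos s.1).mul_const
    (Real.sin s.2)).div_const (Real.sin α * Real.cos α)).mul_const (Real.sin θ))
  rw [E3.ext_iff, e0, e1, e2]
  simp only [PiLp.smul_apply, Matrix.cons_val, smul_eq_mul]
  refine ⟨?_, ?_, ?_⟩ <;> ring

lemma fderiv_stdParam_zero_one {α ε θ : ℝ} {s : ℝ × ℝ}
    (hA : 0 < Real.sin α ^ 2 - Real.sin s.1 ^ 2)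
    (hB : 0 < Real.cos α ^ 2 - Real.sin s.2 ^ 2) :
    fderiv ℝ (stdParam α ε θ) s (0, 1) = (Real.sin α * Real.cos α)⁻¹ •
      !₂[-(Real.sin s.1 * Real.sin s.2 * Real.cos θ),
        -ε * √(Real.sin α ^ 2 - Real.sin s.1 ^ 2)
          * (Real.sin s.2 * Real.cos s.2 / √(Real.cos α ^ 2 - Real.sin s.2 ^ 2)),
        Real.cos s.1 * Real.cos s.2 * Real.sin θ] := by
  have hd := (contDiffAt_stdParam (ε := ε) (θ := θ) hA hB).differentiableAt (by simp)
  have e0 := fderiv_apply_zero_one hd (i := 0) ((((Real.hasDerivAt_cos s.2).const_mul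
    (Real.sin s.1)).div_const (Real.sin α * Real.cos α)).mul_const (Real.cos θ))
  have e1 := fderiv_apply_zero_one hd (i := 1) ((((hasDerivAt_sqrt_sub hB).const_mul
    √(Real.sin α ^ 2 - Real.sin s.1 ^ 2)).div_const (Real.sin α * Real.cos α)).const_mul ε)
  have e2 := fderiv_apply_zero_one hd (i := 2) ((((Real.hasDerivAt_sin s.2).const_mul
    (Real.cos s.1)).div_const (Real.sin α * Real.cos α)).mul_const (Real.sin θ))
  rw [E3.ext_iff, e0, e1, e2]
  simp only [PiLp.smul_apply, Matrix.cons_val, smul_eq_mul]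
  refine ⟨?_, ?_, ?_⟩ <;> ring

/-! ### Rodrigues equations, orthogonality and regularity. -/

section Rodrigues

variable {α ε θ : ℝ} {s : ℝ × ℝ} (hα : α ∈ Ioo 0 (Real.pi / 2))
  (hA : 0 < Real.sin α ^ 2 - Real.sin s.1 ^ 2) (hB : 0 < Real.cos α ^ 2 - Real.sin s.2 ^ 2)
  (hP : 0 < normFactor (Real.sin α) (Real.cos α) (Real.cos θ) s.1)
  (hQ : 0 < normFactor (Real.cos α) (Real.sin α) (Real.sin θ) s.2)
include hα hA hB hP hQ

/-- Only the `s₁` factor of each component is differentiated, and the constants agree. The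
multiplier contains `sin θ cos θ`, so it vanishes for the flat members, as it must. -/
lemma fderiv_stdNormal_one_zero :
    fderiv ℝ (stdNormal α ε θ) s (1, 0) =
      (Real.sin α ^ 3 * Real.cos α ^ 3 * Real.sin θ * Real.cos θ /
        (√(normFactor (Real.sin α) (Real.cos α) (Real.cos θ) s.1) ^ 3
          * √(normFactor (Real.cos α) (Real.sin α) (Real.sin θ) s.2))) •
        fderiv ℝ (stdParam α ε θ) s (1, 0) := by
  have hS := sin_pos_of_mem hα
  have hC := cos_pos_of_mem hα
  have hSC := Real.sin_sq_add_cos_sq α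
  have hcs := Real.cos_sq_add_sin_sq θ
  have hd := (contDiffAt_stdNormal (ε := ε) hA hB hP hQ).differentiableAt (by simp)
  have e0 := fderiv_apply_one_zero hd (i := 0) (((hasDerivAt_sin_div hP).const_mul
    (Real.cos α ^ 2 * Real.sin θ)).mul_const
      (Real.cos s.2 / √(normFactor (Real.cos α) (Real.sin α) (Real.sin θ) s.2)))
  have e1 := fderiv_apply_one_zero hd (i := 1) (((hasDerivAt_sqrt_sub_div hP hA).const_mul
    (ε * Real.cos θ * Real.sin θ)).mul_const (√(Real.cos α ^ 2 - Real.sin s.2 ^ 2)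
        / √(normFactor (Real.cos α) (Real.sin α) (Real.sin θ) s.2)))
  have e2 := fderiv_apply_one_zero hd (i := 2) (((hasDerivAt_cos_div hP hSC hcs).const_mul
    (Real.sin α ^ 2 * Real.cos θ)).mul_const
      (Real.sin s.2 / √(normFactor (Real.cos α) (Real.sin α) (Real.sin θ) s.2)))
  have hD := Real.sqrt_pos.2 hP
  have hE := Real.sqrt_pos.2 hQ
  have hA1 := Real.sqrt_pos.2 hA
  rw [E3.ext_iff, e0, e1, e2, fderiv_stdParam_one_zero hA hB]
  simp only [PiLp.smul_apply, Matrix.cons_val, smul_eq_mul]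
  refine ⟨?_, ?_, ?_⟩ <;> field_simp

lemma fderiv_stdNormal_zero_one :
    fderiv ℝ (stdNormal α ε θ) s (0, 1) =
      (Real.sin α ^ 3 * Real.cos α ^ 3 * Real.sin θ * Real.cos θ /
        (√(normFactor (Real.sin α) (Real.cos α) (Real.cos θ) s.1)
          * √(normFactor (Real.cos α) (Real.sin α) (Real.sin θ) s.2) ^ 3)) •
        fderiv ℝ (stdParam α ε θ) s (0, 1) := by
  have hS := sin_pos_of_mem hα
  have hC := cos_pos_of_mem hα
  have hSC := Real.cos_sq_add_sin_sq α
  have hcs := Real.sin_sq_add_cos_sq θ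
  have hd := (contDiffAt_stdNormal (ε := ε) hA hB hP hQ).differentiableAt (by simp)
  have e0 := fderiv_apply_zero_one hd (i := 0) ((hasDerivAt_cos_div hQ hSC hcs).const_mul
    (Real.cos α ^ 2 * Real.sin θ *
      (Real.sin s.1 / √(normFactor (Real.sin α) (Real.cos α) (Real.cos θ) s.1))))
  have e1 := fderiv_apply_zero_one hd (i := 1) ((hasDerivAt_sqrt_sub_div hQ hB).const_mul
    (ε * Real.cos θ * Real.sin θ * (√(Real.sin α ^ 2 - Real.sin s.1 ^ 2)
        / √(normFactor (Real.sin α) (Real.cos α) (Real.cos θ) s.1))))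
  have e2 := fderiv_apply_zero_one hd (i := 2) ((hasDerivAt_sin_div hQ).const_mul
    (Real.sin α ^ 2 * Real.cos θ *
      (Real.cos s.1 / √(normFactor (Real.sin α) (Real.cos α) (Real.cos θ) s.1))))
  have hD := Real.sqrt_pos.2 hP
  have hE := Real.sqrt_pos.2 hQ
  have hB1 := Real.sqrt_pos.2 hB
  rw [E3.ext_iff, e0, e1, e2, fderiv_stdParam_zero_one hA hB]
  simp only [PiLp.smul_apply, Matrix.cons_val, smul_eq_mul]
  refine ⟨?_, ?_, ?_⟩ <;> field_simp

-- The squared length of the unnormalized normal factors as the product of the two `normFactor`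
-- values.
omit hα in
lemma norm_stdNormal (hε : ε = 1 ∨ ε = -1) : ‖stdNormal α ε θ s‖ = 1 := by
  have hε2 : ε ^ 2 = 1 := by rcases hε with rfl | rfl <;> norm_num
  have hD := Real.sqrt_pos.2 hP
  have hE := Real.sqrt_pos.2 hQ
  have hSC := Real.sin_sq_add_cos_sq α
  have hcs := Real.cos_sq_add_sin_sq θ
  rw [← sq_eq_sq₀ (norm_nonneg _) zero_le_one, EuclideanSpace.real_norm_sq_eq,
    Fin.sum_univ_three]
  simp only [stdNormal, Matrix.cons_val, mul_pow, div_pow]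
  rw [Real.sq_sqrt hP.le, Real.sq_sqrt hQ.le, Real.sq_sqrt hA.le, Real.sq_sqrt hB.le, hε2,
    Real.cos_sq' s.1, Real.cos_sq' s.2]
  field_simp
  simp only [normFactor]
  have h1 : Real.cos α ^ 2 = 1 - Real.sin α ^ 2 := by linarith
  have h2 : Real.cos θ ^ 2 = 1 - Real.sin θ ^ 2 := by linarith
  have h3 : Real.cos α ^ 4 = (1 - Real.sin α ^ 2) ^ 2 := by rw [← h1]; ring
  simp only [h1, h2, h3]
  ring

omit hα hP hQ in
lemma inner_stdNormal_one_zero (hε : ε = 1 ∨ ε = -1) :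
    inner ℝ (stdNormal α ε θ s) (fderiv ℝ (stdParam α ε θ) s (1, 0)) = 0 := by
  have hε2 : ε ^ 2 = 1 := by rcases hε with rfl | rfl <;> norm_num
  have hA1 := Real.sqrt_pos.2 hA
  have hB2 := Real.sq_sqrt hB.le
  have hSC := Real.sin_sq_add_cos_sq α
  rw [fderiv_stdParam_one_zero hA hB, inner_smul_right, PiLp.inner_apply, Fin.sum_univ_three]
  simp only [stdNormal, Matrix.cons_val, RCLike.inner_apply, conj_trivial]
  -- Orthogonality does not depend on the normalization, so the two roots may be arbitrary numbers.
  generalize √(normFactor (Real.sin α) (Real.cos α) (Real.cos θ) s.1) = D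
  generalize √(normFactor (Real.cos α) (Real.sin α) (Real.sin θ) s.2) = E
  have h2 := Real.cos_sq' s.2
  set B := √(Real.cos α ^ 2 - Real.sin s.2 ^ 2)
  set A := √(Real.sin α ^ 2 - Real.sin s.1 ^ 2)
  rw [mul_eq_zero]
  right
  have e : A⁻¹ * A = 1 := inv_mul_cancel₀ hA1.ne'
  simp only [div_eq_mul_inv]
  have hk : ∀ K : ℝ, K * (Real.cos α ^ 2 * Real.cos s.2 ^ 2 - ε ^ 2 * (A⁻¹ * A) * B ^ 2
      - Real.sin α ^ 2 * Real.sin s.2 ^ 2) = 0 := by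
    intro K
    rw [e, hε2, hB2, h2]
    linear_combination (-K * Real.sin s.2 ^ 2) * hSC
  linear_combination hk (Real.sin θ * Real.cos θ * Real.sin s.1 * Real.cos s.1 * D⁻¹ * E⁻¹)

omit hα hP hQ in
lemma inner_stdNormal_zero_one (hε : ε = 1 ∨ ε = -1) :
    inner ℝ (stdNormal α ε θ s) (fderiv ℝ (stdParam α ε θ) s (0, 1)) = 0 := by
  have hε2 : ε ^ 2 = 1 := by rcases hε with rfl | rfl <;> norm_num
  have hB1 := Real.sqrt_pos.2 hB
  have hA2 := Real.sq_sqrt hA.le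
  have hSC := Real.sin_sq_add_cos_sq α
  rw [fderiv_stdParam_zero_one hA hB, inner_smul_right, PiLp.inner_apply, Fin.sum_univ_three]
  simp only [stdNormal, Matrix.cons_val, RCLike.inner_apply, conj_trivial]
  generalize √(normFactor (Real.sin α) (Real.cos α) (Real.cos θ) s.1) = D
  generalize √(normFactor (Real.cos α) (Real.sin α) (Real.sin θ) s.2) = E
  have h2 := Real.cos_sq' s.1
  set B := √(Real.cos α ^ 2 - Real.sin s.2 ^ 2)
  set A := √(Real.sin α ^ 2 - Real.sin s.1 ^ 2)
  rw [mul_eq_zero]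
  right
  have e : B⁻¹ * B = 1 := inv_mul_cancel₀ hB1.ne'
  simp only [div_eq_mul_inv]
  have hk : ∀ K : ℝ, K * (-(Real.cos α ^ 2 * Real.sin s.1 ^ 2) - ε ^ 2 * (B⁻¹ * B) * A ^ 2
      + Real.sin α ^ 2 * Real.cos s.1 ^ 2) = 0 := by
    intro K
    rw [e, hε2, hA2, h2]
    linear_combination (-K * Real.sin s.1 ^ 2) * hSC
  linear_combination hk (Real.sin θ * Real.cos θ * Real.sin s.2 * Real.cos s.2 * D⁻¹ * E⁻¹)

omit hα hP hQ in
lemma inner_fderiv_stdParam (hε : ε = 1 ∨ ε = -1) :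
    inner ℝ (fderiv ℝ (stdParam α ε θ) s (1, 0)) (fderiv ℝ (stdParam α ε θ) s (0, 1)) = 0 := by
  have hε2 : ε ^ 2 = 1 := by rcases hε with rfl | rfl <;> norm_num
  have hA1 := Real.sqrt_pos.2 hA
  have hB1 := Real.sqrt_pos.2 hB
  have hcs := Real.cos_sq_add_sin_sq θ
  rw [fderiv_stdParam_one_zero hA hB, fderiv_stdParam_zero_one hA hB, inner_smul_right,
    inner_smul_left, PiLp.inner_apply, Fin.sum_univ_three]
  simp only [Matrix.cons_val, RCLike.inner_apply, conj_trivial]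
  rw [mul_eq_zero]
  right
  rw [mul_eq_zero]
  right
  field_simp
  linear_combination (Real.sin s.1 * Real.cos s.1 * Real.sin s.2 * Real.cos s.2) * (hε2 - hcs)

omit hQ in
lemma fderiv_stdParam_one_zero_ne_zero (hε : ε = 1 ∨ ε = -1) :
    fderiv ℝ (stdParam α ε θ) s (1, 0) ≠ 0 := by
  have hε2 : ε ^ 2 = 1 := by rcases hε with rfl | rfl <;> norm_num
  have hSC0 := (mul_pos (sin_pos_of_mem hα) (cos_pos_of_mem hα)).ne'
  have hA1 := Real.sqrt_pos.2 hA
  have hSC := Real.sin_sq_add_cos_sq α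
  have hcs := Real.cos_sq_add_sin_sq θ
  have h1 := Real.cos_sq' s.1
  have h2 := Real.cos_sq' s.2
  rw [fderiv_stdParam_one_zero hA hB]
  refine smul_ne_zero (inv_ne_zero hSC0) fun h => ?_
  have e0 := congrArg (fun p : E3 => p 0) h
  have e1 := congrArg (fun p : E3 => p 1) h
  have e2 := congrArg (fun p : E3 => p 2) h
  simp only [Matrix.cons_val, PiLp.zero_apply] at e0 e1 e2
  replace e1 : Real.sin s.1 * Real.cos s.1 * √(Real.cos α ^ 2 - Real.sin s.2 ^ 2) = 0 := by
    have hε0 : ε ≠ 0 := by rcases hε with rfl | rfl <;> norm_num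
    field_simp at e1
    simpa [hε0] using e1
  have f0 := congrArg (· ^ 2) e0
  have f1 := congrArg (· ^ 2) e1
  have f2 := congrArg (· ^ 2) e2
  simp only [mul_pow, neg_sq, h1, h2, Real.sq_sqrt hB.le] at f0 f1 f2
  -- Up to the factors cleared above, the left side is the squared length of the partial derivative.
  -- Its first factor is positive because `sin² s₁ < sin² α` and `sin² s₂ < cos² α`.
  have key : (1 - Real.sin s.1 ^ 2 - Real.sin s.2 ^ 2)
      * normFactor (Real.sin α) (Real.cos α) (Real.cos θ) s.1 = 0 := by
    rw [normFactor]
    have h3 : Real.cos α ^ 2 = 1 - Real.sin α ^ 2 := by linarith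
    have h4 : Real.sin θ ^ 2 = 1 - Real.cos θ ^ 2 := by linarith
    rw [h3] at f1 ⊢
    rw [h4] at f2
    linear_combination (Real.sin α ^ 2 - Real.sin s.1 ^ 2) * (f0 + f2) + f1
  have : 0 < 1 - Real.sin s.1 ^ 2 - Real.sin s.2 ^ 2 := by linarith
  exact (mul_pos this hP).ne' key

omit hP in
lemma fderiv_stdParam_zero_one_ne_zero (hε : ε = 1 ∨ ε = -1) :
    fderiv ℝ (stdParam α ε θ) s (0, 1) ≠ 0 := by
  have hε2 : ε ^ 2 = 1 := by rcases hε with rfl | rfl <;> norm_num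
  have hSC0 := (mul_pos (sin_pos_of_mem hα) (cos_pos_of_mem hα)).ne'
  have hB1 := Real.sqrt_pos.2 hB
  have hSC := Real.sin_sq_add_cos_sq α
  have hcs := Real.cos_sq_add_sin_sq θ
  have h1 := Real.cos_sq' s.1
  have h2 := Real.cos_sq' s.2
  rw [fderiv_stdParam_zero_one hA hB]
  refine smul_ne_zero (inv_ne_zero hSC0) fun h => ?_
  have e0 := congrArg (fun p : E3 => p 0) h
  have e1 := congrArg (fun p : E3 => p 1) h
  have e2 := congrArg (fun p : E3 => p 2) h
  simp only [Matrix.cons_val, PiLp.zero_apply] at e0 e1 e2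
  replace e1 : Real.sin s.2 * Real.cos s.2 * √(Real.sin α ^ 2 - Real.sin s.1 ^ 2) = 0 := by
    have hε0 : ε ≠ 0 := by rcases hε with rfl | rfl <;> norm_num
    field_simp at e1
    rw [mul_comm]
    simpa [hε0, or_assoc] using e1
  have f0 := congrArg (· ^ 2) e0
  have f1 := congrArg (· ^ 2) e1
  have f2 := congrArg (· ^ 2) e2
  simp only [mul_pow, neg_sq, h1, h2, Real.sq_sqrt hA.le] at f0 f1 f2
  have key : (1 - Real.sin s.1 ^ 2 - Real.sin s.2 ^ 2)
      * normFactor (Real.cos α) (Real.sin α) (Real.sin θ) s.2 = 0 := by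
    rw [normFactor]
    have h3 : Real.sin α ^ 2 = 1 - Real.cos α ^ 2 := by linarith
    have h4 : Real.cos θ ^ 2 = 1 - Real.sin θ ^ 2 := by linarith
    rw [h3] at f1 ⊢
    rw [h4] at f0
    linear_combination (Real.cos α ^ 2 - Real.sin s.2 ^ 2) * (f0 + f2) + f1
  have : 0 < 1 - Real.sin s.1 ^ 2 - Real.sin s.2 ^ 2 := by linarith
  exact (mul_pos this hQ).ne' key

end Rodrigues

/-! ### Assembly. -/

lemma isCurvatureLineParametrizationOn_stdParam {α ε θ : ℝ} (hα : α ∈ Ioo 0 (Real.pi / 2))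
    (hε : ε = 1 ∨ ε = -1) {U : Set (ℝ × ℝ)} (hU : IsOpen U)
    (hsub : U ⊆ Ioo (-α) α ×ˢ Ioo (-(Real.pi / 2 - α)) (Real.pi / 2 - α))
    (h1 : ∀ s ∈ U, Real.cos θ ≠ 0 ∨ s.1 ≠ 0) (h2 : ∀ s ∈ U, Real.sin θ ≠ 0 ∨ s.2 ≠ 0) :
    IsCurvatureLineParametrizationOn (stdParam α ε θ) U := by
  have hpi := Real.pi_pos
  have hA : ∀ s ∈ U, 0 < Real.sin α ^ 2 - Real.sin s.1 ^ 2 := fun s hs =>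
    sub_pos.2 (sin_sq_lt_sin_sq (hsub hs).1 hα.2.le)
  have hB : ∀ s ∈ U, 0 < Real.cos α ^ 2 - Real.sin s.2 ^ 2 := fun s hs => by
    have := sin_sq_lt_sin_sq (hsub hs).2 (by linarith [hα.1])
    rw [Real.sin_pi_div_two_sub] at this
    exact sub_pos.2 this
  have sin_ne : ∀ x : ℝ, -Real.pi < x → x < Real.pi → x ≠ 0 → Real.sin x ≠ 0 :=
    fun x h1 h2 h3 h => h3 ((Real.sin_eq_zero_iff_of_lt_of_lt h1 h2).1 h)
  have hP : ∀ s ∈ U, 0 < normFactor (Real.sin α) (Real.cos α) (Real.cos θ) s.1 := fun s hs => by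
    obtain ⟨⟨l1, l2⟩, -⟩ := hsub hs
    exact normFactor_pos (hA s hs) (cos_pos_of_mem hα)
      ((h1 s hs).imp_right (sin_ne _ (by linarith [hα.2]) (by linarith [hα.2])))
  have hQ : ∀ s ∈ U, 0 < normFactor (Real.cos α) (Real.sin α) (Real.sin θ) s.2 := fun s hs => by
    obtain ⟨-, l1, l2⟩ := hsub hs
    exact normFactor_pos (hB s hs) (sin_pos_of_mem hα)
      ((h2 s hs).imp_right (sin_ne _ (by linarith [hα.1]) (by linarith [hα.1])))
  refine ⟨hU, fun s hs => (contDiffAt_stdParam (hA s hs) (hB s hs)).contDiffWithinAt,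
    fun s hs => injective_of_inner_eq_zero (inner_fderiv_stdParam (hA s hs) (hB s hs) hε)
      (fderiv_stdParam_one_zero_ne_zero hα (hA s hs) (hB s hs) (hP s hs) hε)
      (fderiv_stdParam_zero_one_ne_zero hα (hA s hs) (hB s hs) (hQ s hs) hε),
    stdNormal α ε θ, fun s hs => (contDiffAt_stdNormal (hA s hs) (hB s hs) (hP s hs)
      (hQ s hs)).contDiffWithinAt, fun s hs => ⟨?_, ?_, ?_, ?_, ?_⟩⟩
  · exact norm_stdNormal (hA s hs) (hB s hs) (hP s hs) (hQ s hs) hε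
  · intro v
    rw [clm_prod_apply, inner_add_right, inner_smul_right, inner_smul_right,
      inner_stdNormal_one_zero (hA s hs) (hB s hs) hε,
      inner_stdNormal_zero_one (hA s hs) (hB s hs) hε]
    simp
  · exact inner_fderiv_stdParam (hA s hs) (hB s hs) hε
  · exact exists_neg_smul (fderiv_stdNormal_one_zero hα (hA s hs) (hB s hs) (hP s hs) (hQ s hs))
  · exact exists_neg_smul (fderiv_stdNormal_zero_one hα (hA s hs) (hB s hs) (hP s hs) (hQ s hs))

end

theorem mainTheorem10 (a b c : ℝ) (hab : b < a) (hbc : c < b) (hc : 0 < c) :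
    -- the two maps parametrize the two halves of each member of the family
    (∀ s₃ ∈ Ico (0 : ℝ) Real.pi, ∀ ε : ℝ, ε = 1 ∨ ε = -1 →
      ContinuousOn (param a b c ε s₃) (rect a b c) ∧
      param a b c ε s₃ '' rect a b c = ellipsoidFamily a b c s₃ ∩ halfSpace ε) ∧
    -- genuine ellipsoids: bijective curvature line parametrizations
    (∀ s₃ ∈ Ico (0 : ℝ) Real.pi, s₃ ≠ 0 → s₃ ≠ Real.pi / 2 → ∀ ε : ℝ, ε = 1 ∨ ε = -1 →
      BijOn (param a b c ε s₃) (rect a b c) (ellipsoid a b c s₃ ∩ halfSpace ε) ∧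
      IsCurvatureLineParametrizationOn (param a b c ε s₃) (openRect a b c)) ∧
    -- planar degenerations: each of the two sheets of the doubly covered half disc
    -- is parametrized bijectively, and by curvature lines away from the fold
    (∀ ε : ℝ, ε = 1 ∨ ε = -1 → ∀ η : ℝ, η = 1 ∨ η = -1 →
      BijOn (param a b c ε 0) (rect a b c ∩ {s | 0 ≤ η * s.2})
        (ellipsoidFamily a b c 0 ∩ halfSpace ε) ∧
      BijOn (param a b c ε (Real.pi / 2)) (rect a b c ∩ {s | 0 ≤ η * s.1})
        (ellipsoidFamily a b c (Real.pi / 2) ∩ halfSpace ε)) ∧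
    (∀ ε : ℝ, ε = 1 ∨ ε = -1 →
      IsCurvatureLineParametrizationOn (param a b c ε 0)
        (openRect a b c ∩ {s | s.2 ≠ 0}) ∧
      IsCurvatureLineParametrizationOn (param a b c ε (Real.pi / 2))
        (openRect a b c ∩ {s | s.1 ≠ 0})) ∧
    -- the curves `s₁ ± s₂ = k` are circles, and circular sections of the ellipsoids
    (∀ δ : ℝ, δ = 1 ∨ δ = -1 → ∀ k ∈ Icc (-(Real.pi / 2)) (Real.pi / 2),
      ∃ ρ : ℝ, 0 ≤ ρ ∧ (0 < ρ ↔ |k| < Real.pi / 2) ∧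
        ∀ s₃ ∈ Ico (0 : ℝ) Real.pi, ∃ P : AffineSubspace ℝ E3,
          IsCircleInPlane P ρ (diagCurve a b c δ k s₃) ∧
          (s₃ ≠ 0 → s₃ ≠ Real.pi / 2 →
            diagCurve a b c δ k s₃ = ellipsoid a b c s₃ ∩ (P : Set E3))) ∧
    -- corresponding curves are congruent, by a congruence matching the parameters
    (∀ δ : ℝ, δ = 1 ∨ δ = -1 → ∀ k ∈ Icc (-(Real.pi / 2)) (Real.pi / 2),
      ∀ s₃ ∈ Ico (0 : ℝ) Real.pi, ∀ s₃' ∈ Ico (0 : ℝ) Real.pi, ∃ φ : E3 ≃ᵢ E3,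
        φ '' diagCurve a b c δ k s₃ = diagCurve a b c δ k s₃' ∧
        ∀ ε : ℝ, ε = 1 ∨ ε = -1 → ∀ s ∈ diagLine a b c δ k,
          φ (param a b c ε s₃ s) = param a b c ε s₃' s) ∧
    -- the two planar degenerations
    (∀ s₃ ∈ Ico (0 : ℝ) Real.pi,
      (ellipsoidFamily a b c s₃ ⊆ {p | p 2 = 0} ↔ s₃ = 0) ∧
      (ellipsoidFamily a b c s₃ ⊆ {p | p 0 = 0} ↔ s₃ = Real.pi / 2)) ∧
    Tendsto (fun t => Metric.hausdorffEDist (ellipsoid a b c t) (ellipsoidFamily a b c 0))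
      (𝓝[≠] 0) (𝓝 0) ∧
    Tendsto (fun t => Metric.hausdorffEDist (ellipsoid a b c t)
      (ellipsoidFamily a b c (Real.pi / 2))) (𝓝[≠] (Real.pi / 2)) (𝓝 0) ∧
    -- the unit sphere
    (Real.arctan √((a - b) / (b - c)) ∈ Ioo (0 : ℝ) (Real.pi / 2) ∧
      ellipsoid a b c (Real.arctan √((a - b) / (b - c))) = Metric.sphere (0 : E3) 1) := by
  have hpi := Real.pi_pos
  have hα := s₁Max_mem hab hbc
  have hsin : ∀ t ∈ Ico (0 : ℝ) Real.pi, Real.sin t = 0 ↔ t = 0 := fun t ht =>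
    Real.sin_eq_zero_iff_of_lt_of_lt (by linarith [ht.1]) ht.2
  have hcos : ∀ t ∈ Ico (0 : ℝ) Real.pi, Real.cos t = 0 ↔ t = Real.pi / 2 := fun t ht =>
    ⟨fun h => Real.injOn_cos ⟨ht.1, ht.2.le⟩ ⟨by linarith, by linarith⟩
      (h.trans Real.cos_pi_div_two.symm), fun h => h ▸ Real.cos_pi_div_two⟩
  have hopen : IsOpen (openRect a b c) := isOpen_Ioo.prod isOpen_Ioo
  simp only [param_eq_stdParam hab hbc, rect_eq]
  refine ⟨fun s₃ _ ε hε => ⟨(continuous_stdParam _ ε s₃).continuousOn,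
      stdParam_image hab hbc s₃ hε⟩, fun s₃ hs₃ h0 h1 ε hε => ?_,
    fun ε hε η hη => ⟨bijOn_flat_xy hab hbc hε hη, bijOn_flat_yz hab hbc hε hη⟩,
    fun ε hε => ⟨?_, ?_⟩, fun δ hδ k hk => ⟨Real.cos k, Real.cos_nonneg_of_mem_Icc hk, ?_,
      fun s₃ hs₃ => ⟨_, isCircleInPlane_diagCurve hab hbc hδ hk s₃, fun h0 h1 => ?_⟩⟩,
    fun δ hδ k hk s₃ _ s₃' _ => ?_, fun s₃ hs₃ => ⟨?_, ?_⟩, ?_, ?_, ⟨?_, ?_⟩,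
    ellipsoid_arctan_eq_sphere hab hbc⟩
  · have n0 := (hsin s₃ hs₃).not.2 h0
    have n1 := (hcos s₃ hs₃).not.2 h1
    refine ⟨?_, isCurvatureLineParametrizationOn_stdParam hα hε hopen Subset.rfl
      (fun _ _ => Or.inl n1) (fun _ _ => Or.inl n0)⟩
    rw [← ellipsoidFamily_eq_ellipsoid n0 n1, ← stdParam_image hab hbc s₃ hε]
    exact (stdParam_injOn hα ε n0 n1).bijOn_image
  -- At `s₃ = 0` the `s₁` factor never degenerates, since `cos 0 ≠ 0`; only the line `s₂ = 0` must
  -- be removed.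
  · exact isCurvatureLineParametrizationOn_stdParam hα hε
      (hopen.inter (isOpen_ne_fun continuous_snd continuous_const)) inter_subset_left
      (fun _ _ => Or.inl (by simp)) (fun s hs => Or.inr hs.2)
  · exact isCurvatureLineParametrizationOn_stdParam hα hε
      (hopen.inter (isOpen_ne_fun continuous_fst continuous_const)) inter_subset_left
      (fun s hs => Or.inr hs.2) (fun _ _ => Or.inl (by simp))
  · rw [abs_lt]
    constructor
    · intro h
      refine ⟨hk.1.lt_of_ne fun e => ?_, hk.2.lt_of_ne fun e => ?_⟩
      · rw [← e, Real.cos_neg, Real.cos_pi_div_two] at h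
        exact h.false
      · rw [e, Real.cos_pi_div_two] at h
        exact h.false
    · exact fun h => Real.cos_pos_of_mem_Ioo h
  · exact diagCurve_eq_inter hab hbc hδ hk ((hsin s₃ hs₃).not.2 h0) ((hcos s₃ hs₃).not.2 h1)
  · obtain ⟨φ, h1, h2⟩ := exists_congruence_diagCurve hab hbc hδ hk s₃ s₃'
    simp only [param_eq_stdParam hab hbc] at h2
    exact ⟨φ, h1, fun ε _ => h2 ε⟩
  · rw [ellipsoidFamily_subset_xy_iff hab hbc, hsin s₃ hs₃]
  · rw [ellipsoidFamily_subset_yz_iff hab hbc, hcos s₃ hs₃]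
  · apply tendsto_hausdorffEDist_ellipsoid hab hbc
    have : Ioo (-(Real.pi / 2)) (Real.pi / 2) ∈ 𝓝 (0 : ℝ) :=
      Ioo_mem_nhds (by linarith) (by linarith)
    filter_upwards [self_mem_nhdsWithin, nhdsWithin_le_nhds this] with t ht0 ht
    exact ⟨fun h => ht0 ((Real.sin_eq_zero_iff_of_lt_of_lt (by linarith [ht.1])
      (by linarith [ht.2])).1 h), (Real.cos_pos_of_mem_Ioo ht).ne'⟩
  · apply tendsto_hausdorffEDist_ellipsoid hab hbc
    have : Ioo 0 Real.pi ∈ 𝓝 (Real.pi / 2) := Ioo_mem_nhds (by linarith) (by linarith)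
    filter_upwards [self_mem_nhdsWithin, nhdsWithin_le_nhds this] with t ht0 ht
    exact ⟨(Real.sin_pos_of_mem_Ioo ht).ne', fun h => ht0 ((hcos t ⟨ht.1.le, ht.2⟩).1 h)⟩
  · exact Real.arctan_pos.2 (Real.sqrt_pos.2 (div_pos (by linarith) (by linarith)))
  · exact Real.arctan_lt_pi_div_two _
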